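/- Let $a,b,A\in\mathbb{C}$, $0<\lambda<\infty$, $\mu<1$, and $\zeta\in\mathbb{C}$ with $|\zeta|=1$, $\zeta\neq 1$. Let $\theta\in(0,\pi)$ be such that $\lambda\theta<2\pi$ and such that the sectors $|\arg z|\le\theta$ and $|\arg(z/\zeta)|\le\theta$ (with $z\ne0$) are disjoint. All powers, logarithms and arguments are principal ($-\pi<\arg\le\pi$). Let $f$ be an entire function with two directions of maximal exponential growth, in the sense that $$f(z)=\begin{cases} z^a\exp(z^\lambda)\,[1+o(1)] & \text{for } |\arg z|\le\theta,\\ A(z/\zeta)^b\exp\big((z/\zeta)^\lambda\big)\,[1+o(1)] & \text{for } |\arg(z/\zeta)|\le\theta,\\ O\big(\exp(\mu|z|^\lambda)\big) & \text{otherwise}\end{cases}$$ as $|z|\to\infty$, each estimate being uniform in its region. Put $$p_n(z)=\sum_{k=0}^n\frac{f^{(k)}(0)}{k!}z^k,\qquad r_n=\Big(\frac n\lambda\Big)^{1/\lambda},\qquad S=\big\{z\in\mathbb{C}: |z^\lambda\exp(1-z^\lambda)|=1,\ |z|\le1\big\}.$$ Let $\xi\in S$ with $|\arg\xi|<\theta$,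 $\xi\ne1$, and let $\tau=\operatorname{Im}(\xi^\lambda-1-\lambda\log\xi)$. Let $\tau_n,\sigma_n\in(-\pi,\pi]$ be defined by $\tau_n\equiv\tau n/\lambda$ and $\sigma_n\equiv n\arg\zeta \pmod{2\pi}$, and let $$z_n^1(w)=\xi\left(1+\frac{\log n}{2(1-\xi^\lambda)n}-\frac{w-i\tau_n}{(1-\xi^\lambda)n}\right),$$ $$z_n^2(w)=\xi\left(1+\Big(a-b+\frac\lambda2\Big)\frac{\log n}{\lambda(1-\xi^\lambda)n}-\frac{w-i\sigma_n-i\tau_n}{(1-\xi^\lambda)n}\right).$$ Then, as $n\to\infty$: 1. if $\operatorname{Re}a>\operatorname{Re}b$, then $\displaystyle \frac{p_{n-1}(r_nz_n^1(w))}{f(r_nz_n^1(w))}\to 1-\frac{e^{-w}}{\xi^a(1-\xi)\sqrt{2\pi\lambda}}$; 2. if $\operatorname{Re}a<\operatorname{Re}b$, then $\displaystyle \frac{p_{n-1}(r_nz_n^2(w))}{f(r_nz_n^2(w))}\to 1-\frac{A\zeta\lambda^{(a-b)/\lambda}e^{-w}}{\xi^a(\zeta-\xi)\sqrt{2\pi\lambda}}$;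 3. if $\operatorname{Re}a=\operatorname{Re}b$, then $\displaystyle \frac{p_{n-1}(r_nz_n^1(w))}{f(r_nz_n^1(w))}= 1-\left(\frac1{1-\xi}+\frac{A\zeta^{1-n}r_n^{b-a}}{\zeta-\xi}\right)\frac{e^{-w}}{\xi^a\sqrt{2\pi\lambda}}+o(1)$. In each case the convergence is uniform for $w$ in any compact subset of $\mathbb{C}$; in particular, for each compact set the denominator does not vanish on it once $n$ is large. -/

import Mathlib

open Filter Topology Asymptotics Bornology

noncomputable section

namespace ArcScaling

/-- The closed sector `|arg (z / ζ)| ≤ θ`, with its vertex at the origin removed. -/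
def sector (ζ : ℂ) (θ : ℝ) : Set ℂ := {z | z ≠ 0 ∧ |(z / ζ).arg| ≤ θ}

/-- The asymptotic behaviour of `f` as `|z| → ∞`, uniformly in each region:
`f z ~ z ^ a * exp (z ^ lam)` on `|arg z| ≤ θ`,
`f z ~ A * (z / ζ) ^ b * exp ((z / ζ) ^ lam)` on `|arg (z / ζ)| ≤ θ`,
`f z = O (exp (μ * |z| ^ lam))` elsewhere. All complex powers are principal. -/
structure TwoDirectionGrowth (f : ℂ → ℂ) (a b A : ℂ) (lam μ : ℝ) (ζ : ℂ) (θ : ℝ) : Prop where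
  first : IsEquivalent (cobounded ℂ ⊓ 𝓟 (sector 1 θ)) f
    (fun z => z ^ a * Complex.exp (z ^ (lam : ℂ)))
  second : IsEquivalent (cobounded ℂ ⊓ 𝓟 (sector ζ θ)) f
    (fun z => A * (z / ζ) ^ b * Complex.exp ((z / ζ) ^ (lam : ℂ)))
  rest : IsBigO (cobounded ℂ ⊓ 𝓟 (sector 1 θ ∪ sector ζ θ)ᶜ) f
    (fun z => Real.exp (μ * ‖z‖ ^ lam))

/-- The `n`-th Maclaurin partial sum `p_n (z) = ∑_{k = 0}^n f^{(k)}(0) / k! * z ^ k`. -/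
def partialSum (f : ℂ → ℂ) (n : ℕ) (z : ℂ) : ℂ :=
  ∑ k ∈ Finset.range (n + 1), iteratedDeriv k f 0 / (k.factorial : ℂ) * z ^ k

/-- The scaling radius `r_n = (n / lam) ^ (1 / lam)`. -/
def radius (lam : ℝ) (n : ℕ) : ℝ := ((n : ℝ) / lam) ^ (1 / lam)

/-- The limit curve `|z ^ lam * exp (1 - z ^ lam)| = 1`, `|z| ≤ 1`. -/
def limitCurve (lam : ℝ) : Set ℂ :=
  {z | ‖z ^ (lam : ℂ) * Complex.exp (1 - z ^ (lam : ℂ))‖ = 1 ∧ ‖z‖ ≤ 1}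

/-- The representative of `x` modulo `2 * π` in the interval `(-π, π]`. -/
def angleRep (x : ℝ) : ℝ := toIocMod Real.two_pi_pos (-Real.pi) x

/-- `τ = Im (ξ ^ lam - 1 - lam * log ξ)`. -/
def tau (lam : ℝ) (ξ : ℂ) : ℝ := (ξ ^ (lam : ℂ) - 1 - (lam : ℂ) * Complex.log ξ).im

/-- `τ_n ≡ τ * n / lam` modulo `2 * π`, in `(-π, π]`. -/
def tauSeq (lam : ℝ) (ξ : ℂ) (n : ℕ) : ℝ := angleRep (tau lam ξ * n / lam)

/-- `σ_n ≡ n * arg ζ` modulo `2 * π`, in `(-π, π]`. -/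
def sigmaSeq (ζ : ℂ) (n : ℕ) : ℝ := angleRep (n * ζ.arg)

/-- The scaling variable `z_n^1 (w)`. -/
def zOne (lam : ℝ) (ξ : ℂ) (n : ℕ) (w : ℂ) : ℂ :=
  ξ * (1 + (Real.log n : ℂ) / (2 * (1 - ξ ^ (lam : ℂ)) * n)
    - (w - Complex.I * tauSeq lam ξ n) / ((1 - ξ ^ (lam : ℂ)) * n))

/-- The scaling variable `z_n^2 (w)`. -/
def zTwo (a b : ℂ) (lam : ℝ) (ζ ξ : ℂ) (n : ℕ) (w : ℂ) : ℂ :=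
  ξ * (1 + (a - b + (lam : ℂ) / 2) * ((Real.log n : ℂ) / (lam * (1 - ξ ^ (lam : ℂ)) * n))
    - (w - Complex.I * sigmaSeq ζ n - Complex.I * tauSeq lam ξ n)
      / ((1 - ξ ^ (lam : ℂ)) * n))

/-- The quotient `p_{n-1} (r_n z) / f (r_n z)`. -/
def ratio (f : ℂ → ℂ) (lam : ℝ) (n : ℕ) (z : ℂ) : ℂ :=
  partialSum f (n - 1) (radius lam n * z) / f (radius lam n * z)

end ArcScaling

end

open ArcScaling

namespace ArcScaling

open Complex MeasureTheory

/-! For `|z| < 1`, Cauchy's formula on the circle of radius `r = r_n` writes `f (r z) - p_{n-1} (r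
z)` as `z ^ n / (2π)` times the integral of `f (r u) u ^ (-n) u / (u - z)` over the unit circle.
Since `r ^ λ = n / λ`, on the sector around `1` the integrand is, up to the factor `r ^ a exp (n /
λ)`, a slowly varying function times `exp ((n / λ) (e^{iλt} - 1 - iλt))`. This has a Gaussian peak
of width `n ^ (-1/2)` at `t = 0`, so Laplace's method gives the constant `√(2π / λ) / (1 - ξ)` after
multiplication by `√n`. Rotation by `ζ` gives the same peak in the other sector, with `r ^ b ζ ^
(-n) A ζ / (ζ - ξ)` in place of `r ^ a / (1 - ξ)`. The rest of the circle is smaller by the factor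
`exp (-(1 - μ) n / λ)`, up to powers of `n`.

It remains to divide by `f (r z) ~ r ^ a z ^ a exp ((n / λ) z ^ λ)`. Put `z = ξ (1 + p / ((1 - ξ ^
λ) n))` with `p = o(√n)`. A first-order expansion of `log z - z ^ λ / λ` at `ξ`, together with `ξ ^
λ - 1 - λ log ξ = iτ` on the curve, gives `z ^ n exp ((n / λ) (1 - z ^ λ)) ~ exp (p - iτn / λ)`. The
two scalings choose `p` so that this factor compensates `1 / √n` and makes the first or the second
peak of order one. The carrying lemmas are `sub_partialSum_eq`, `tendsto_laplace`,
`tendsto_integral_rest`, `tendsto_saddle` and `exists_ratio_eq`.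

Uniformity in `w` is built in: the limits are proved along an arbitrary filter, later taken to be
`atTop ×ˢ 𝓟 K` on pairs `(n, w)`. -/

/-! ### Cauchy's integral for the Taylor remainder -/

/-- The integrand on the unit circle in the Cauchy formula for the remainder of a Taylor series. -/
noncomputable def remainderKernel (f : ℂ → ℂ) (r : ℝ) (n : ℕ) (z u : ℂ) : ℂ :=
  f (r * u) * (u ^ n)⁻¹ * (u / (u - z))

/-- Both `f z` and its Taylor coefficients are Cauchy integrals, and subtracting the finite
geometric sum of `z ^ k / s ^ (k + 1)` from `1 / (s - z)` leaves `(z / s) ^ n / (s - z)`. -/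
theorem sub_sum_eq_circleIntegral {f : ℂ → ℂ} (hf : Differentiable ℂ f) {R : ℝ} (hR : 0 < R)
    (n : ℕ) {z : ℂ} (hz : ‖z‖ < R) :
    f z - ∑ k ∈ Finset.range n, iteratedDeriv k f 0 / (k.factorial : ℂ) * z ^ k =
      (2 * Real.pi * I)⁻¹ * ∮ s in C(0, R), f s * ((z / s) ^ n / (s - z)) := by
  have hs0 : ∀ s ∈ Metric.sphere (0 : ℂ) R, s ≠ 0 := fun s hs h => by
    simp [h] at hs; exact hR.ne hs
  have hsz : ∀ s ∈ Metric.sphere (0 : ℂ) R, s - z ≠ 0 := fun s hs h => by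
    rw [sub_eq_zero] at h
    simp [h] at hs; exact hz.ne hs
  have hpi : (2 * Real.pi * I : ℂ) ≠ 0 := by simp [Real.pi_ne_zero]
  have h1 : ∮ s in C(0, R), (s - z)⁻¹ * f s = 2 * Real.pi * I * f z := by
    have := hf.differentiableOn.circleIntegral_sub_inv_smul (c := 0) (R := R) (w := z)
      (by simpa using hz)
    simpa using this
  have h2 : ∀ k : ℕ, ∮ s in C(0, R), z ^ k * (1 / s ^ (k + 1) * f s) =
      2 * Real.pi * I * (iteratedDeriv k f 0 / (k.factorial : ℂ) * z ^ k) := by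
    intro k
    have := (hf.differentiableOn (s := Metric.closedBall 0 R)).circleIntegral_one_div_sub_center_pow_smul hR k
    simp only [sub_zero, smul_eq_mul] at this
    rw [circleIntegral.integral_const_mul, this]
    ring
  have hci : ∀ k ∈ Finset.range n,
      CircleIntegrable (fun s => z ^ k * (1 / s ^ (k + 1) * f s)) 0 R := by
    intro k _
    refine ContinuousOn.circleIntegrable hR.le ?_
    refine continuousOn_const.mul (ContinuousOn.mul ?_ hf.continuous.continuousOn)
    exact continuousOn_const.div (by fun_prop) fun s hs => pow_ne_zero _ (hs0 s hs)
  have h3 : CircleIntegrable (fun s => (s - z)⁻¹ * f s) 0 R := by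
    refine ContinuousOn.circleIntegrable hR.le (ContinuousOn.mul ?_ hf.continuous.continuousOn)
    exact ContinuousOn.inv₀ (by fun_prop) hsz
  rw [eq_inv_mul_iff_mul_eq₀ hpi, mul_sub, Finset.mul_sum, ← h1, ← Finset.sum_congr rfl fun k _ => h2 k,
    ← circleIntegral.integral_fun_sum hci, ← circleIntegral.integral_sub h3
      (CircleIntegrable.fun_sum _ hci)]
  refine circleIntegral.integral_congr hR.le fun s hs => ?_
  have e0 := hs0 s hs
  have ez := hsz s hs
  have hne : z / s ≠ 1 := fun h => ez (by rw [div_eq_one_iff_eq e0] at h; rw [h, sub_self])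
  have hsum : ∑ k ∈ Finset.range n, z ^ k * (1 / s ^ (k + 1) * f s) =
      (∑ k ∈ Finset.range n, (z / s) ^ k) * (f s / s) := by
    rw [Finset.sum_mul]
    refine Finset.sum_congr rfl fun k _ => ?_
    rw [div_pow]; field_simp; ring
  have hne' : z / s - 1 ≠ 0 := sub_ne_zero.2 hne
  have : z - s ≠ 0 := by rw [← neg_sub]; exact neg_ne_zero.2 ez
  rw [hsum, geom_sum_eq hne]
  generalize (z / s) ^ n = q
  field_simp
  ring

theorem sub_partialSum_eq {f : ℂ → ℂ} (hf : Differentiable ℂ f) {r : ℝ} (hr : 0 < r)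
    {n : ℕ} (hn : n ≠ 0) {z : ℂ} (hz : ‖z‖ < 1) :
    f (r * z) - partialSum f (n - 1) (r * z) = z ^ n / (2 * Real.pi) *
      ∫ t in (0 : ℝ)..2 * Real.pi, remainderKernel f r n z (exp (t * I)) := by
  have hpi : (2 * Real.pi * I : ℂ) ≠ 0 := by simp [Real.pi_ne_zero]
  rw [partialSum, Nat.sub_add_cancel (Nat.one_le_iff_ne_zero.2 hn),
    sub_sum_eq_circleIntegral hf hr n (by rw [norm_mul, norm_real, Real.norm_of_nonneg hr.le]; nlinarith),
    circleIntegral, ← intervalIntegral.integral_const_mul, ← intervalIntegral.integral_const_mul]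
  refine intervalIntegral.integral_congr fun t _ => ?_
  have hr' : (r : ℂ) ≠ 0 := ofReal_ne_zero.2 hr.ne'
  have he := exp_ne_zero (t * I)
  have hez : exp (t * I) - z ≠ 0 := fun h => by
    rw [sub_eq_zero] at h
    rw [← h, norm_exp_ofReal_mul_I] at hz
    exact lt_irrefl _ hz
  have hπ : (Real.pi : ℂ) ≠ 0 := ofReal_ne_zero.2 Real.pi_ne_zero
  simp only [remainderKernel, deriv_circleMap, circleMap, zero_add, smul_eq_mul, ← mul_sub]
  rw [mul_div_mul_left _ _ hr', div_pow]
  field_simp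

/-! ### Sectors and the splitting of the circle -/

theorem exp_mul_I_mem_sector {θ t : ℝ} (ht : t ∈ Set.Ioc (-Real.pi) Real.pi) :
    exp (t * I) ∈ sector 1 θ ↔ |t| ≤ θ := by
  rw [sector, Set.mem_ofPred_eq, div_one, exp_mul_I, arg_cos_add_sin_mul_I ht, ← exp_mul_I]
  simp [exp_ne_zero]

theorem mul_mem_sector {ζ : ℂ} {θ r : ℝ} (hr : 0 < r) (u : ℂ) :
    (r : ℂ) * u ∈ sector ζ θ ↔ u ∈ sector ζ θ := by
  simp only [sector, Set.mem_ofPred_eq, mul_div_assoc, arg_real_mul _ hr, mul_ne_zero_iff,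
    ofReal_ne_zero, hr.ne', ne_eq, not_false_eq_true, true_and]

theorem mul_mem_sector_self {ζ : ℂ} (hζ : ζ ≠ 0) {θ : ℝ} (u : ℂ) :
    ζ * u ∈ sector ζ θ ↔ u ∈ sector 1 θ := by
  simp [sector, hζ]

theorem measurableSet_sector (ζ : ℂ) (θ : ℝ) : MeasurableSet (sector ζ θ) := by
  refine (measurableSet_singleton 0).compl.inter ?_
  exact measurableSet_le (continuous_abs.measurable.comp
    (measurable_arg.comp (measurable_id.div_const ζ))) measurable_const

theorem periodic_comp_exp_mul_I (F : ℂ → ℂ) :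
    Function.Periodic (fun t : ℝ => F (exp (t * I))) (2 * Real.pi) := by
  intro t
  have : ((t + 2 * Real.pi : ℝ) : ℂ) * I = t * I + 2 * Real.pi * I := by push_cast; ring
  simp only [this, exp_periodic (t * I)]

theorem integral_indicator_sector_one {θ : ℝ} (hθ0 : 0 < θ) (hθπ : θ < Real.pi) (Q : ℂ → ℂ) :
    ∫ t in -Real.pi..Real.pi, (sector 1 θ).indicator Q (exp (t * I)) =
      ∫ t in -θ..θ, Q (exp (t * I)) := by
  rw [intervalIntegral.integral_of_le (by linarith [Real.pi_pos]),
    intervalIntegral.integral_of_le (by linarith), ← integral_Icc_eq_integral_Ioc (x := -θ),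
    ← integral_indicator measurableSet_Ioc, ← integral_indicator measurableSet_Icc]
  congr 1
  ext t
  by_cases ht : t ∈ Set.Ioc (-Real.pi) Real.pi
  · rw [Set.indicator_of_mem ht]
    by_cases h : |t| ≤ θ
    · rw [Set.indicator_of_mem ((exp_mul_I_mem_sector ht).2 h),
        Set.indicator_of_mem (by exact abs_le.1 h)]
    · rw [Set.indicator_of_notMem (mt (exp_mul_I_mem_sector ht).1 h),
        Set.indicator_of_notMem (s := Set.Icc (-θ) θ) (fun h' => h (abs_le.2 h'))]
  · rw [Set.indicator_of_notMem ht, Set.indicator_of_notMem]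
    exact fun h => ht ⟨by linarith [h.1], by linarith [h.2]⟩

/-- Periodicity allows the window of integration to be shifted by `arg ζ`, so it is harmless that
the sector may cross the branch cut. -/
theorem integral_indicator_sector {ζ : ℂ} (hζ : ‖ζ‖ = 1) {θ : ℝ} (hθ0 : 0 < θ)
    (hθπ : θ < Real.pi) (Q : ℂ → ℂ) :
    ∫ t in -Real.pi..Real.pi, (sector ζ θ).indicator Q (exp (t * I)) =
      ∫ t in -θ..θ, Q (ζ * exp (t * I)) := by
  have hζ0 : ζ ≠ 0 := norm_ne_zero_iff.1 (by rw [hζ]; exact one_ne_zero)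
  have hζe : ζ = exp (ζ.arg * I) := by
    conv_lhs => rw [← norm_mul_exp_arg_mul_I ζ, hζ, ofReal_one, one_mul]
  rw [← integral_indicator_sector_one hθ0 hθπ fun u => Q (ζ * u)]
  have hp := periodic_comp_exp_mul_I ((sector ζ θ).indicator Q)
  have h1 := hp.intervalIntegral_add_eq (-Real.pi) (-Real.pi + ζ.arg)
  rw [show -Real.pi + 2 * Real.pi = Real.pi by ring,
    show -Real.pi + ζ.arg + 2 * Real.pi = Real.pi + ζ.arg by ring,
    ← intervalIntegral.integral_comp_add_right] at h1
  rw [h1]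
  refine intervalIntegral.integral_congr fun t _ => ?_
  have : exp (((t + ζ.arg : ℝ) : ℂ) * I) = ζ * exp (t * I) := by
    rw [hζe, ← exp_add, ← hζe]; congr 1; push_cast; ring
  simp only [this]
  by_cases h : exp (t * I) ∈ sector 1 θ
  · rw [Set.indicator_of_mem h, Set.indicator_of_mem ((mul_mem_sector_self hζ0 _).2 h)]
  · rw [Set.indicator_of_notMem h,
      Set.indicator_of_notMem (mt (mul_mem_sector_self hζ0 _).1 h)]

/-- Keeping the third piece as an indicator avoids describing the complementary arcs, whose shape
depends on the position of `ζ`. -/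
theorem integral_circle_eq_add {ζ : ℂ} (hζ : ‖ζ‖ = 1) {θ : ℝ} (hθ0 : 0 < θ)
    (hθπ : θ < Real.pi) (hdisj : Disjoint (sector 1 θ) (sector ζ θ)) {Q : ℂ → ℂ}
    (hQ : Continuous fun t : ℝ => Q (exp (t * I))) :
    ∫ t in (0 : ℝ)..2 * Real.pi, Q (exp (t * I)) =
      (∫ t in -θ..θ, Q (exp (t * I))) + (∫ t in -θ..θ, Q (ζ * exp (t * I))) +
      ∫ t in -Real.pi..Real.pi, (sector 1 θ ∪ sector ζ θ)ᶜ.indicator Q (exp (t * I)) := by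
  have hint : ∀ S : Set ℂ, MeasurableSet S →
      IntervalIntegrable (fun t : ℝ => S.indicator Q (exp (t * I))) volume (-Real.pi) Real.pi := by
    intro S hS
    have hi := (hQ.intervalIntegrable (μ := volume) (-Real.pi) Real.pi)
    rw [intervalIntegrable_iff] at hi ⊢
    have hS' : MeasurableSet ((fun t : ℝ => exp (t * I)) ⁻¹' S) :=
      hS.preimage (by fun_prop)
    exact hi.indicator hS'
  have hp := periodic_comp_exp_mul_I Q
  have h1 := hp.intervalIntegral_add_eq 0 (-Real.pi)
  rw [show -Real.pi + 2 * Real.pi = Real.pi by ring, zero_add] at h1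
  have m1 := measurableSet_sector 1 θ
  have m2 := measurableSet_sector ζ θ
  rw [h1, ← integral_indicator_sector_one hθ0 hθπ, ← integral_indicator_sector hζ hθ0 hθπ,
    ← intervalIntegral.integral_add (hint _ m1) (hint _ m2),
    ← intervalIntegral.integral_add ((hint _ m1).add (hint _ m2)) (hint _ (m1.union m2).compl)]
  refine intervalIntegral.integral_congr fun t _ => ?_
  have e1 := congrFun (Set.indicator_union_of_disjoint hdisj Q) (exp (t * I))
  have e2 := congrFun (Set.indicator_self_add_compl (sector 1 θ ∪ sector ζ θ) Q) (exp (t * I))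
  simp only [Pi.add_apply] at e1 e2 ⊢
  rw [← e2, e1]

/-! ### The scaling radius and principal powers -/

theorem radius_pos {lam : ℝ} (hlam : 0 < lam) {n : ℕ} (hn : n ≠ 0) : 0 < radius lam n :=
  Real.rpow_pos_of_pos (div_pos (Nat.cast_pos.2 (Nat.pos_of_ne_zero hn)) hlam) _

theorem radius_rpow {lam : ℝ} (hlam : 0 < lam) (n : ℕ) : radius lam n ^ lam = n / lam := by
  rw [radius, ← Real.rpow_mul (by positivity), one_div_mul_cancel hlam.ne', Real.rpow_one]

theorem tendsto_radius {lam : ℝ} (hlam : 0 < lam) : Tendsto (radius lam) atTop atTop :=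
  (tendsto_rpow_atTop (one_div_pos.2 hlam)).comp
    (tendsto_natCast_atTop_atTop.atTop_div_const hlam)

theorem cpow_ofReal_mul {r : ℝ} (hr : 0 < r) {z : ℂ} (hz : z ≠ 0) (b : ℂ) :
    ((r : ℂ) * z) ^ b = (r : ℂ) ^ b * z ^ b := by
  have hr' : (r : ℂ) ≠ 0 := ofReal_ne_zero.2 hr.ne'
  rw [cpow_def_of_ne_zero (mul_ne_zero hr' hz), cpow_def_of_ne_zero hr', cpow_def_of_ne_zero hz,
    log_ofReal_mul hr hz, ← exp_add, ofReal_log hr.le]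
  ring_nf

theorem exp_mul_I_cpow {t : ℝ} (ht : t ∈ Set.Ioc (-Real.pi) Real.pi) (b : ℂ) :
    exp (t * I) ^ b = exp (b * (t * I)) := by
  rw [cpow_def_of_ne_zero (exp_ne_zero _), log_exp (by simpa using ht.1) (by simpa using ht.2),
    mul_comm]

theorem radius_mul_cpow {lam : ℝ} (hlam : 0 < lam) {n : ℕ} (hn : n ≠ 0) {z : ℂ} (hz : z ≠ 0) :
    ((radius lam n : ℂ) * z) ^ (lam : ℂ) = n / lam * z ^ (lam : ℂ) := by
  have hr := radius_pos hlam hn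
  rw [cpow_ofReal_mul hr hz, ← ofReal_cpow hr.le, radius_rpow hlam]
  push_cast; ring

/-! ### Laplace's method at a peak -/

/-- This is where `λθ < 2π` enters the Laplace estimate: `t = 0` is then the only maximum of `cos
(λt)` on the sector, and the phase has a Gaussian majorant there. -/
theorem exists_cos_le_one_sub_mul_sq {x₀ : ℝ} (hx₀ : x₀ < 2 * Real.pi) :
    ∃ c > 0, ∀ x : ℝ, |x| ≤ x₀ → Real.cos x ≤ 1 - c * x ^ 2 := by
  have hπ := Real.pi_pos
  set d := 2 * Real.pi - x₀ with hd
  have hd0 : 0 < d := by linarith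
  -- The first constant serves `|x| ≤ π`. Beyond `π`, reflection to `2π - |x| ≥ d` leaves a gap of
  -- at least `2 d² / π²`, and `x² ≤ 4π²` turns this into a multiple of `x²`.
  refine ⟨min (2 / Real.pi ^ 2) (2 / Real.pi ^ 2 * d ^ 2 / (4 * Real.pi ^ 2)), by positivity,
    fun x hx => ?_⟩
  rcases le_or_gt |x| Real.pi with h | h
  · refine (Real.cos_le_one_sub_mul_cos_sq h).trans ?_
    have := mul_le_mul_of_nonneg_right (min_le_left (2 / Real.pi ^ 2)
      (2 / Real.pi ^ 2 * d ^ 2 / (4 * Real.pi ^ 2))) (sq_nonneg x)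
    linarith
  · have h1 : Real.cos x = Real.cos (2 * Real.pi - |x|) := by
      rw [Real.cos_two_pi_sub, Real.cos_abs]
    have h2 : |(2 * Real.pi - |x|)| ≤ Real.pi := abs_le.2 ⟨by linarith, by linarith⟩
    rw [h1]
    refine (Real.cos_le_one_sub_mul_cos_sq h2).trans ?_
    have h3 := mul_le_mul_of_nonneg_right (min_le_right (2 / Real.pi ^ 2)
      (2 / Real.pi ^ 2 * d ^ 2 / (4 * Real.pi ^ 2))) (sq_nonneg x)
    have h4 : d ^ 2 ≤ (2 * Real.pi - |x|) ^ 2 := by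
      apply pow_le_pow_left₀ hd0.le; linarith
    have h5 : x ^ 2 ≤ 4 * Real.pi ^ 2 := by
      rw [← sq_abs]; nlinarith [abs_nonneg x]
    have h6 : 2 / Real.pi ^ 2 * d ^ 2 / (4 * Real.pi ^ 2) * x ^ 2 ≤ 2 / Real.pi ^ 2 * d ^ 2 := by
      rw [div_mul_eq_mul_div, div_le_iff₀ (by positivity)]
      gcongr
    have h7 : 2 / Real.pi ^ 2 * d ^ 2 ≤ 2 / Real.pi ^ 2 * (2 * Real.pi - |x|) ^ 2 := by gcongr
    linarith

/-- The exponential factor at angle `t` of the integrand, relative to its value at `t = 0`. -/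
noncomputable def phase (lam : ℝ) (n : ℕ) (t : ℝ) : ℂ :=
  exp (n / lam * (exp (lam * t * I) - 1 - lam * t * I))

theorem norm_phase (lam : ℝ) (n : ℕ) (t : ℝ) :
    ‖phase lam n t‖ = Real.exp (n / lam * (Real.cos (lam * t) - 1)) := by
  rw [phase, norm_exp]
  have h1 : (exp (lam * t * I)).re = Real.cos (lam * t) := by
    rw [← ofReal_mul, exp_ofReal_mul_I_re]
  have h2 : ((n : ℂ) / lam) = ((n / lam : ℝ) : ℂ) := by push_cast; rfl
  rw [h2, re_ofReal_mul, sub_re, sub_re, h1, ← ofReal_mul, re_ofReal_mul]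
  simp

/-- The relation `r ^ λ = n / λ` makes `t = 0` a critical point: `u ^ (-n)` supplies exactly the
term `-iλt` that cancels the linear part of `e^{iλt}`. -/
theorem model_eq_phase {lam : ℝ} (hlam : 0 < lam) {n : ℕ} (hn : n ≠ 0) (b : ℂ) {t : ℝ}
    (ht : t ∈ Set.Ioc (-Real.pi) Real.pi) :
    exp (-(n / lam)) * (radius lam n : ℂ) ^ (-b) * ((radius lam n * exp (t * I)) ^ b *
      exp ((radius lam n * exp (t * I)) ^ (lam : ℂ))) * (exp (t * I) ^ n)⁻¹ =
      exp (b * (t * I)) * phase lam n t := by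
  have hr := radius_pos hlam hn
  have hr' : (radius lam n : ℂ) ≠ 0 := ofReal_ne_zero.2 hr.ne'
  have hl : (lam : ℂ) ≠ 0 := ofReal_ne_zero.2 hlam.ne'
  have hb : (radius lam n : ℂ) ^ (-b) * (radius lam n : ℂ) ^ b = 1 := by
    rw [← cpow_add _ _ hr', neg_add_cancel, cpow_zero]
  rw [radius_mul_cpow hlam hn (exp_ne_zero _), cpow_ofReal_mul hr (exp_ne_zero _),
    exp_mul_I_cpow ht, exp_mul_I_cpow ht, ← exp_nat_mul, ← exp_neg]
  have h3 : phase lam n t = exp (-(n / lam)) * exp (n / lam * exp (lam * (t * I))) *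
      exp (-(n * (t * I))) := by
    rw [phase, ← exp_add, ← exp_add]
    congr 1
    rw [← mul_assoc (lam : ℂ)]
    field_simp
    ring
  rw [h3]
  linear_combination (exp (-(n / lam)) * exp (n / lam * exp (lam * (t * I))) *
      exp (-(n * (t * I))) * exp (b * (t * I))) * hb

/-- With `x = iλs / √n`, the quadratic term of `exp x` contributes `-λs² / 2`, and the cubic
remainder, multiplied by `n / λ`, is `O(n ^ (-1/2))`. -/
theorem tendsto_phase {ι : Type*} {L : Filter ι} {N : ι → ℕ} (hN : Tendsto N L atTop)
    {lam : ℝ} (hlam : 0 < lam) (s : ℝ) :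
    Tendsto (fun i => phase lam (N i) (s / √(N i))) L
      (𝓝 (Real.exp (-(lam / 2) * s ^ 2) : ℝ)) := by
  have hl : (lam : ℂ) ≠ 0 := ofReal_ne_zero.2 hlam.ne'
  have hsq : Tendsto (fun i => √(N i : ℝ)) L atTop :=
    Real.tendsto_sqrt_atTop.comp (tendsto_natCast_atTop_atTop.comp hN)
  have hx : Tendsto (fun i => (lam * (s / √(N i) : ℝ) * I : ℂ)) L (𝓝 0) := by
    have : Tendsto (fun i => s / √(N i : ℝ)) L (𝓝 0) := hsq.const_div_atTop s
    have h2 := ((continuous_ofReal.tendsto 0).comp this)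
    have h3 := (h2.const_mul (lam : ℂ)).mul_const I
    simpa using h3
  rw [ofReal_exp]
  refine (continuous_exp.tendsto _).comp ?_
  rw [← tendsto_sub_nhds_zero_iff]
  have hb : Tendsto (fun i => (lam ^ 2 * |s| ^ 3) / √(N i : ℝ)) L (𝓝 0) := hsq.const_div_atTop _
  refine squeeze_zero_norm' ?_ hb
  have hsmall : ∀ᶠ i in L, ‖(lam * (s / √(N i) : ℝ) * I : ℂ)‖ ≤ 1 := by
    have := hx.norm
    rw [norm_zero] at this
    exact this.eventually_le_const one_pos
  filter_upwards [hsmall, hN.eventually_ge_atTop 1] with i hi hi1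
  have hn : (0 : ℝ) < N i := by exact_mod_cast hi1
  have hq : (0 : ℝ) < √(N i : ℝ) := Real.sqrt_pos.2 hn
  have hqq : √(N i : ℝ) ^ 2 = N i := Real.sq_sqrt hn.le
  set x : ℂ := lam * (s / √(N i) : ℝ) * I with hxdef
  have hbd := Complex.exp_bound hi (n := 3) (by norm_num)
  have hx2 : x ^ 2 = -(lam ^ 2 * s ^ 2 / N i) := by
    have : ((√(N i : ℝ) : ℝ) : ℂ) ^ 2 = N i := by exact_mod_cast congrArg ofReal hqq
    rw [hxdef, ← this]
    push_cast
    rw [mul_pow, I_sq, mul_pow, div_pow]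
    ring
  have hN0 : (N i : ℂ) ≠ 0 := by exact_mod_cast hn.ne'
  have e : (N i / lam * (exp x - 1 - x) - ((-(lam / 2) * s ^ 2 : ℝ) : ℂ)) =
      N i / lam * (exp x - ∑ m ∈ Finset.range 3, x ^ m / m.factorial) := by
    simp only [Finset.sum_range_succ, Finset.sum_range_zero, Nat.factorial]
    push_cast
    rw [hx2]
    field_simp
    ring
  have hnx : ‖x‖ = lam * |s| / √(N i : ℝ) := by
    rw [hxdef, norm_mul, norm_I, mul_one, norm_mul, norm_real, norm_real, Real.norm_of_nonneg hlam.le,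
      norm_div, Real.norm_of_nonneg hq.le, Real.norm_eq_abs, mul_div_assoc]
  rw [e, norm_mul]
  have hnl : ‖(N i / lam : ℂ)‖ = N i / lam := by
    rw [norm_div, norm_natCast, norm_real, Real.norm_of_nonneg hlam.le]
  rw [hnl]
  calc (N i : ℝ) / lam * ‖exp x - ∑ m ∈ Finset.range 3, x ^ m / m.factorial‖
      ≤ (N i : ℝ) / lam * ‖x‖ ^ 3 := by
        gcongr
        refine hbd.trans ?_
        have : ((Nat.succ 3 : ℕ) * ((Nat.factorial 3 : ℕ) * (3 : ℕ) : ℝ)⁻¹ : ℝ) ≤ 1 := by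
          norm_num [Nat.factorial]
        have h3 : 0 ≤ ‖x‖ ^ 3 := by positivity
        have := mul_le_mul_of_nonneg_left this h3
        simpa using this
    _ = lam ^ 2 * |s| ^ 3 / √(N i : ℝ) := by
        rw [hnx]
        generalize √(N i : ℝ) = q at hq hqq
        rw [← hqq]
        field_simp

theorem tendsto_sqrt_natCast {ι : Type*} {L : Filter ι} {N : ι → ℕ} (hN : Tendsto N L atTop) :
    Tendsto (fun i => √(N i : ℝ)) L atTop :=
  Real.tendsto_sqrt_atTop.comp (tendsto_natCast_atTop_atTop.comp hN)

theorem sqrt_mul_integral_eq_integral_indicator {n : ℕ} (hn : n ≠ 0) {θ : ℝ} (hθ : 0 < θ)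
    (F : ℝ → ℂ) :
    (√(n : ℝ) : ℂ) * ∫ t in -θ..θ, F t =
      ∫ s : ℝ, (Set.Ioc (-(θ * √(n : ℝ))) (θ * √(n : ℝ))).indicator
        (fun s => F (s / √(n : ℝ))) s := by
  have hq : 0 < √(n : ℝ) := Real.sqrt_pos.2 (Nat.cast_pos.2 (Nat.pos_of_ne_zero hn))
  rw [integral_indicator measurableSet_Ioc,
    ← intervalIntegral.integral_of_le (by nlinarith [mul_pos hθ hq]),
    intervalIntegral.integral_comp_div F hq.ne', neg_div, mul_div_cancel_right₀ _ hq.ne',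
    real_smul]

theorem norm_kernel_le {η u z : ℂ} (hη : ‖η‖ = 1) (hu : ‖u‖ = 1) {ρ : ℝ} (hρ : ρ < 1)
    (hz : ‖z‖ ≤ ρ) : ‖η * u / (η * u - z)‖ ≤ (1 - ρ)⁻¹ := by
  have h1 : ‖η * u‖ = 1 := by rw [norm_mul, hη, hu, one_mul]
  have h2 : 1 - ρ ≤ ‖η * u - z‖ := by
    have := norm_sub_norm_le (η * u) z
    linarith
  rw [norm_div, h1, one_div]
  exact inv_anti₀ (by linarith) h2

theorem sub_ne_zero_of_norm_lt {v z : ℂ} (hv : ‖v‖ = 1) (hz : ‖z‖ < 1) : v - z ≠ 0 := fun h => by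
  rw [sub_eq_zero] at h
  rw [← h, hv] at hz
  exact lt_irrefl _ hz

/-- After `t = s / √n` the integrand converges pointwise to a Gaussian under a Gaussian majorant, so
dominated convergence applies. The unit `η` lets one statement serve both peaks: `η = 1` with `f`,
and `η = ζ` with `f (ζ ·)`. -/
theorem tendsto_laplace {ι : Type*} {L : Filter ι} [L.IsCountablyGenerated] {N : ι → ℕ}
    (hN : Tendsto N L atTop) {g : ℂ → ℂ} (hg : Continuous g) {A b : ℂ} {lam θ : ℝ}
    (hlam : 0 < lam) (hθ0 : 0 < θ) (hθπ : θ < Real.pi) (hθlam : lam * θ < 2 * Real.pi)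
    (hga : IsEquivalent (cobounded ℂ ⊓ 𝓟 (sector 1 θ)) g
      (fun z => A * z ^ b * exp (z ^ (lam : ℂ))))
    {η : ℂ} (hη : ‖η‖ = 1) {z : ι → ℂ} {ξ : ℂ} (hz : Tendsto z L (𝓝 ξ)) (hξ : ‖ξ‖ < 1) :
    Tendsto (fun i => (√(N i : ℝ) : ℂ) * (exp (-(N i / lam)) * (radius lam (N i) : ℂ) ^ (-b) *
      ∫ t in -θ..θ, g (radius lam (N i) * exp (t * I)) * (exp (t * I) ^ N i)⁻¹ *
        (η * exp (t * I) / (η * exp (t * I) - z i)))) L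
      (𝓝 (A * (η / (η - ξ)) * (√(2 * Real.pi / lam) : ℝ))) := by
  obtain ⟨φ, hφ, hgφ⟩ := hga.exists_eq_mul
  obtain ⟨c, hc, hcos⟩ := exists_cos_le_one_sub_mul_sq hθlam
  -- The threshold depends on `‖v‖` alone, so for large `n` the bound holds at every angle of the
  -- sector at once, as the majorant requires.
  obtain ⟨R, hR⟩ : ∃ R : ℝ, ∀ v : ℂ, R ≤ ‖v‖ → v ∈ sector 1 θ →
      g v = φ v * (A * v ^ b * exp (v ^ (lam : ℂ))) ∧ ‖φ v‖ ≤ 2 := by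
    have h2 : ∀ᶠ v in cobounded ℂ ⊓ 𝓟 (sector 1 θ), ‖φ v‖ ≤ 2 := by
      have := hφ.norm
      rw [norm_one] at this
      exact this.eventually_le_const one_lt_two
    have h := hgφ.and h2
    rw [eventually_inf_principal, ← comap_norm_atTop, eventually_comap] at h
    obtain ⟨R, hR⟩ := eventually_atTop.1 h
    exact ⟨R, fun v hv hs => hR _ hv v rfl hs⟩
  have hrad : Tendsto (fun i => radius lam (N i)) L atTop := (tendsto_radius hlam).comp hN
  have hsq := tendsto_sqrt_natCast hN
  -- A radius strictly between `‖ξ‖` and `1` keeps the pole `z i` away from the unit circle.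
  set ρ := (1 + ‖ξ‖) / 2 with hρ
  have hρ1 : ρ < 1 := by linarith
  have hzρ : ∀ᶠ i in L, ‖z i‖ ≤ ρ := hz.norm.eventually_le_const (by linarith)
  let F : ι → ℝ → ℂ := fun i t => exp (-(N i / lam)) * (radius lam (N i) : ℂ) ^ (-b) *
    (g (radius lam (N i) * exp (t * I)) * (exp (t * I) ^ N i)⁻¹ *
        (η * exp (t * I) / (η * exp (t * I) - z i)))
  have hFeq : ∀ᶠ i in L, ∀ t : ℝ, |t| ≤ θ → F i t = A * φ (radius lam (N i) * exp (t * I)) *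
      exp (b * (t * I)) * phase lam (N i) t * (η * exp (t * I) / (η * exp (t * I) - z i)) ∧
      ‖φ (radius lam (N i) * exp (t * I))‖ ≤ 2 := by
    filter_upwards [hrad.eventually_ge_atTop R, hN.eventually_ge_atTop 1] with i hi hi1 t ht
    have hn : N i ≠ 0 := Nat.one_le_iff_ne_zero.1 hi1
    have hr := radius_pos hlam hn
    have htπ : t ∈ Set.Ioc (-Real.pi) Real.pi :=
      ⟨by linarith [(abs_le.1 ht).1], by linarith [(abs_le.1 ht).2]⟩
    have hmem : (radius lam (N i) : ℂ) * exp (t * I) ∈ sector 1 θ :=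
      (mul_mem_sector hr _).2 ((exp_mul_I_mem_sector htπ).2 ht)
    have hnorm : ‖(radius lam (N i) : ℂ) * exp (t * I)‖ = radius lam (N i) := by
      rw [norm_mul, norm_exp_ofReal_mul_I, mul_one, norm_real, Real.norm_of_nonneg hr.le]
    obtain ⟨h1, h2⟩ := hR _ (by rw [hnorm]; exact hi) hmem
    refine ⟨?_, h2⟩
    simp only [F]
    rw [h1]
    linear_combination (A * φ (radius lam (N i) * exp (t * I)) *
      (η * exp (t * I) / (η * exp (t * I) - z i))) * model_eq_phase hlam hn b htπ
  have hFcont : ∀ᶠ i in L, Continuous (F i) := by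
    filter_upwards [hzρ] with i hi
    have hne : ∀ t : ℝ, η * exp (t * I) - z i ≠ 0 := fun t =>
      sub_ne_zero_of_norm_lt (by rw [norm_mul, hη, norm_exp_ofReal_mul_I, one_mul])
        (hi.trans_lt hρ1)
    have hp : ∀ t : ℝ, exp (t * I) ^ N i ≠ 0 := fun t => pow_ne_zero _ (exp_ne_zero _)
    have h1 : Continuous fun t : ℝ => (exp (t * I) ^ N i)⁻¹ :=
      Continuous.inv₀ (by fun_prop) hp
    have h2 : Continuous fun t : ℝ => η * exp (t * I) / (η * exp (t * I) - z i) :=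
      Continuous.div (by fun_prop) (by fun_prop) hne
    have h3 : Continuous fun t : ℝ => g (radius lam (N i) * exp (t * I)) := by fun_prop
    exact continuous_const.mul ((h3.mul h1).mul h2)
  set C : ℝ := ‖A‖ * 2 * Real.exp (‖b‖ * θ) * (1 - ρ)⁻¹ with hC
  have key : Tendsto (fun i => ∫ s : ℝ,
      (Set.Ioc (-(θ * √(N i : ℝ))) (θ * √(N i : ℝ))).indicator (fun s => F i (s / √(N i : ℝ))) s) L
      (𝓝 (∫ s : ℝ, A * (η / (η - ξ)) * ((Real.exp (-(lam / 2) * s ^ 2) : ℝ) : ℂ))) := by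
    refine tendsto_integral_filter_of_dominated_convergence
      (fun s => C * Real.exp (-(c * lam) * s ^ 2)) ?_ ?_ ?_ ?_
    · filter_upwards [hFcont] with i hi
      exact (Continuous.aestronglyMeasurable (by fun_prop)).indicator measurableSet_Ioc
    · filter_upwards [hFeq, hzρ, hN.eventually_ge_atTop 1] with i hi hzi hi1
      refine ae_of_all _ fun s => ?_
      have hn : (0 : ℝ) < N i := by exact_mod_cast hi1
      have hq : 0 < √(N i : ℝ) := Real.sqrt_pos.2 hn
      have hρ0 : 0 < 1 - ρ := by linarith
      by_cases hs : s ∈ Set.Ioc (-(θ * √(N i : ℝ))) (θ * √(N i : ℝ))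
      · rw [Set.indicator_of_mem hs]
        have ht : |s / √(N i : ℝ)| ≤ θ := by
          rw [abs_div, abs_of_pos hq, div_le_iff₀ hq]
          exact abs_le.2 ⟨hs.1.le, hs.2⟩
        obtain ⟨h1, h2⟩ := hi _ ht
        have hst : (N i : ℝ) * (s / √(N i : ℝ)) ^ 2 = s ^ 2 := by
          rw [div_pow, Real.sq_sqrt hn.le]
          field_simp
        have hb : ‖exp (b * ((s / √(N i : ℝ) : ℝ) * I))‖ ≤ Real.exp (‖b‖ * θ) := by
          refine (norm_exp_le_exp_norm _).trans (Real.exp_le_exp.2 ?_)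
          rw [norm_mul, norm_mul, norm_I, mul_one, norm_real, Real.norm_eq_abs]
          gcongr
        have hph : ‖phase lam (N i) (s / √(N i : ℝ))‖ ≤ Real.exp (-(c * lam) * s ^ 2) := by
          rw [norm_phase, Real.exp_le_exp]
          have h3 := hcos (lam * (s / √(N i : ℝ))) (by
            rw [abs_mul, abs_of_pos hlam]; gcongr)
          calc (N i : ℝ) / lam * (Real.cos (lam * (s / √(N i : ℝ))) - 1)
              ≤ (N i : ℝ) / lam * (-(c * (lam * (s / √(N i : ℝ))) ^ 2)) := by
                gcongr; linarith
            _ = -(c * lam) * ((N i : ℝ) * (s / √(N i : ℝ)) ^ 2) := by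
                field_simp
            _ = _ := by rw [hst]
        have hk := norm_kernel_le hη (norm_exp_ofReal_mul_I (s / √(N i : ℝ))) hρ1 hzi
        rw [h1, norm_mul, norm_mul, norm_mul, norm_mul]
        calc _ ≤ ‖A‖ * 2 * Real.exp (‖b‖ * θ) * Real.exp (-(c * lam) * s ^ 2) * (1 - ρ)⁻¹ := by
              gcongr
          _ = _ := by rw [hC]; ring
      · rw [Set.indicator_of_notMem hs, norm_zero]
        positivity
    · exact (integrable_exp_neg_mul_sq (by positivity)).const_mul C
    · refine ae_of_all _ fun s => ?_
      have hev : ∀ᶠ i in L, s ∈ Set.Ioc (-(θ * √(N i : ℝ))) (θ * √(N i : ℝ)) := by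
        filter_upwards [(hsq.const_mul_atTop hθ0).eventually_gt_atTop |s|] with i hi
        exact ⟨(abs_lt.1 hi).1, (abs_lt.1 hi).2.le⟩
      have ht : Tendsto (fun i => s / √(N i : ℝ)) L (𝓝 0) := hsq.const_div_atTop s
      have htθ : ∀ᶠ i in L, |s / √(N i : ℝ)| ≤ θ := by
        have := ht.abs
        rw [abs_zero] at this
        exact this.eventually_le_const hθ0
      have hexp : Tendsto (fun i => exp ((s / √(N i : ℝ) : ℝ) * I)) L (𝓝 1) := by
        have h : Continuous fun t : ℝ => exp (t * I) := by fun_prop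
        have h' := (h.tendsto 0).comp ht
        simp only [ofReal_zero, zero_mul, Complex.exp_zero] at h'
        exact h'
      have hexpb : Tendsto (fun i => exp (b * ((s / √(N i : ℝ) : ℝ) * I))) L (𝓝 1) := by
        have h : Continuous fun t : ℝ => exp (b * (t * I)) := by fun_prop
        have h' := (h.tendsto 0).comp ht
        simp only [ofReal_zero, zero_mul, mul_zero, Complex.exp_zero] at h'
        exact h'
      have hφ1 : Tendsto (fun i => φ (radius lam (N i) * exp ((s / √(N i : ℝ) : ℝ) * I))) L
          (𝓝 1) := by
        refine hφ.comp (tendsto_inf.2 ⟨?_, tendsto_principal.2 ?_⟩)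
        · rw [← tendsto_norm_atTop_iff_cobounded]
          refine hrad.congr' ?_
          filter_upwards [hN.eventually_ge_atTop 1] with i hi1
          rw [norm_mul, norm_exp_ofReal_mul_I, mul_one, norm_real, Real.norm_of_nonneg
            (radius_pos hlam (Nat.one_le_iff_ne_zero.1 hi1)).le]
        · filter_upwards [htθ, hN.eventually_ge_atTop 1] with i hi hi1
          refine (mul_mem_sector (radius_pos hlam (Nat.one_le_iff_ne_zero.1 hi1)) _).2
            ((exp_mul_I_mem_sector ⟨?_, ?_⟩).2 hi)
          · linarith [(abs_le.1 hi).1]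
          · linarith [(abs_le.1 hi).2]
      have hker : Tendsto (fun i => η * exp ((s / √(N i : ℝ) : ℝ) * I) /
          (η * exp ((s / √(N i : ℝ) : ℝ) * I) - z i)) L (𝓝 (η / (η - ξ))) := by
        have h1 := hexp.const_mul η
        rw [mul_one] at h1
        exact h1.div (h1.sub hz) (sub_ne_zero_of_norm_lt hη hξ)
      have hlim := ((((hφ1.const_mul A).mul hexpb).mul (tendsto_phase hN hlam s)).mul hker)
      rw [show A * 1 * 1 * ((Real.exp (-(lam / 2) * s ^ 2) : ℝ) : ℂ) * (η / (η - ξ)) =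
        A * (η / (η - ξ)) * ((Real.exp (-(lam / 2) * s ^ 2) : ℝ) : ℂ) by ring] at hlim
      refine hlim.congr' ?_
      filter_upwards [hev, htθ, hFeq] with i h1 h2 h3
      rw [Set.indicator_of_mem h1, (h3 _ h2).1]
  have hval : (∫ s : ℝ, A * (η / (η - ξ)) * ((Real.exp (-(lam / 2) * s ^ 2) : ℝ) : ℂ)) =
      A * (η / (η - ξ)) * (√(2 * Real.pi / lam) : ℝ) := by
    rw [integral_const_mul, integral_complex_ofReal, integral_gaussian]
    congr 3
    field_simp
  rw [hval] at key
  refine key.congr' ?_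
  filter_upwards [hN.eventually_ge_atTop 1] with i hi1
  rw [← sqrt_mul_integral_eq_integral_indicator (Nat.one_le_iff_ne_zero.1 hi1) hθ0,
    intervalIntegral.integral_const_mul]

/-! ### Geometry of the limit curve -/

section limitCurve

variable {lam θ : ℝ} {ξ : ℂ}

theorem ne_zero_of_mem_limitCurve (hlam : 0 < lam) (hξ : ξ ∈ limitCurve lam) : ξ ≠ 0 := by
  rintro rfl
  have h := hξ.1
  rw [zero_cpow (ofReal_ne_zero.2 hlam.ne')] at h
  simp at h

/-- The modulus condition says that the real part of the left side vanishes, and `tau` is by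
definition its imaginary part. -/
theorem eq_tau_mul_I_of_mem_limitCurve (hlam : 0 < lam) (hξ : ξ ∈ limitCurve lam) :
    ξ ^ (lam : ℂ) - 1 - lam * log ξ = tau lam ξ * I := by
  have h0 := ne_zero_of_mem_limitCurve hlam hξ
  have h := hξ.1
  nth_rw 1 [cpow_def_of_ne_zero h0] at h
  rw [← exp_add, norm_exp, Real.exp_eq_one_iff] at h
  apply Complex.ext
  · simp only [add_re, sub_re, one_re, mul_re, ofReal_re, ofReal_im, I_re, I_im] at h ⊢
    linarith
  · simp [tau]

/-- On the unit circle the curve equation reduces to `cos (λ arg ξ) = 1`. Since `λ |arg ξ| < 2π`,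
this forces `arg ξ = 0` and hence `ξ = 1`. -/
theorem norm_lt_one_of_mem_limitCurve (hlam : 0 < lam) (hθlam : lam * θ < 2 * Real.pi)
    (hξ : ξ ∈ limitCurve lam) (hξθ : |ξ.arg| < θ) (hξ1 : ξ ≠ 1) : ‖ξ‖ < 1 := by
  refine lt_of_le_of_ne hξ.2 fun hn => hξ1 ?_
  have h0 := ne_zero_of_mem_limitCurve hlam hξ
  have hlog : log ξ = ξ.arg * I := by
    apply Complex.ext <;> simp [log_re, log_im, hn]
  have h := congrArg re (eq_tau_mul_I_of_mem_limitCurve hlam hξ)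
  rw [cpow_def_of_ne_zero h0, hlog] at h
  rw [show (ξ.arg : ℂ) * I * lam = ((ξ.arg * lam : ℝ) : ℂ) * I by push_cast; ring] at h
  simp only [sub_re, exp_ofReal_mul_I_re, one_re, mul_re, ofReal_re, ofReal_im, I_re, I_im,
    mul_zero, zero_mul, sub_zero, mul_one] at h
  have hab : |ξ.arg * lam| < 2 * Real.pi := by
    rw [abs_mul, abs_of_pos hlam, mul_comm]
    exact (mul_lt_mul_of_pos_left hξθ hlam).trans hθlam
  have harg : ξ.arg * lam = 0 :=
    (Real.cos_eq_one_iff_of_lt_of_lt (abs_lt.1 hab).1 (abs_lt.1 hab).2).1 (by linarith)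
  have harg' : ξ.arg = 0 := (mul_eq_zero.1 harg).resolve_right hlam.ne'
  rw [← norm_mul_exp_arg_mul_I ξ, hn, harg']
  simp

theorem one_sub_cpow_ne_zero (hlam : 0 < lam) (h1 : ‖ξ‖ < 1) :
    1 - ξ ^ (lam : ℂ) ≠ 0 := by
  refine sub_ne_zero_of_norm_lt norm_one ?_
  rw [norm_cpow_real]
  exact Real.rpow_lt_one (norm_nonneg _) h1 hlam

end limitCurve

/-! ### Local expansion at a point of the curve -/

/-- The complex phase whose `n`-th multiple governs `z ^ n * exp (-(n / lam) * z ^ lam)`. -/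
noncomputable def saddle (lam : ℝ) (z : ℂ) : ℂ := log z - z ^ (lam : ℂ) / lam

theorem analyticAt_saddle (lam : ℝ) {ξ : ℂ} (hξ : ξ ∈ slitPlane) :
    AnalyticAt ℂ (saddle lam) ξ :=
  (analyticAt_id.clog hξ).sub ((analyticAt_id.cpow analyticAt_const hξ).div_const)

theorem hasDerivAt_saddle {lam : ℝ} (hlam : lam ≠ 0) {ξ : ℂ} (hξ : ξ ∈ slitPlane) :
    HasDerivAt (saddle lam) ((1 - ξ ^ (lam : ℂ)) / ξ) ξ := by
  have h0 := slitPlane_ne_zero hξ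
  have hl : (lam : ℂ) ≠ 0 := ofReal_ne_zero.2 hlam
  have h := (hasDerivAt_log hξ).sub
    (((hasDerivAt_id ξ).cpow_const (c := (lam : ℂ)) hξ).div_const (lam : ℂ))
  refine h.congr_deriv ?_
  simp only [id, mul_one]
  rw [cpow_sub _ _ h0, cpow_one]
  field_simp

theorem saddle_isBigO {lam : ℝ} (hlam : lam ≠ 0) {ξ : ℂ} (hξ : ξ ∈ slitPlane) :
    (fun y => saddle lam (ξ + y) - saddle lam ξ - (1 - ξ ^ (lam : ℂ)) / ξ * y) =O[𝓝 0]
      fun y => ‖y‖ ^ 2 := by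
  have h := (analyticAt_saddle lam hξ).hasFPowerSeriesAt
  have h2 := h.isBigO_sub_partialSum_pow 2
  refine h2.congr_left fun y => ?_
  rw [FormalMultilinearSeries.partialSum, Finset.sum_range_succ, Finset.sum_range_one]
  simp only [FormalMultilinearSeries.ofScalars_apply_eq, iteratedDeriv_zero, iteratedDeriv_one,
    (hasDerivAt_saddle hlam hξ).deriv, smul_eq_mul]
  simp
  ring

theorem exp_angleRep_mul_I (x : ℝ) : exp (angleRep x * I) = exp (x * I) := by
  have h := toIocMod_add_toIocDiv_zsmul Real.two_pi_pos (-Real.pi) x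
  rw [exp_eq_exp_iff_exists_int]
  refine ⟨-toIocDiv Real.two_pi_pos (-Real.pi) x, ?_⟩
  nth_rw 2 [← h]
  rw [angleRep]
  push_cast [zsmul_eq_mul]
  ring

theorem abs_angleRep_le (x : ℝ) : |angleRep x| ≤ Real.pi := by
  have h := toIocMod_mem_Ioc Real.two_pi_pos (-Real.pi) x
  rw [angleRep]
  exact abs_le.2 ⟨h.1.le, by linarith [h.2]⟩

section scaling

variable {ι : Type*} {L : Filter ι} {N : ι → ℕ} {p : ι → ℂ}

theorem tendsto_scaled (hN : Tendsto N L atTop) (hp : Tendsto (fun i => p i / √(N i : ℝ)) L (𝓝 0))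
    (ξ m : ℂ) : Tendsto (fun i => ξ * (1 + p i / (m * N i))) L (𝓝 ξ) := by
  have h1 : Tendsto (fun i => ((√(N i : ℝ))⁻¹ : ℂ)) L (𝓝 0) := by
    have := (continuous_ofReal.tendsto 0).comp (tendsto_sqrt_natCast hN).inv_tendsto_atTop
    simpa [Function.comp_def] using this
  have h2 : Tendsto (fun i => p i / (m * N i)) L (𝓝 0) := by
    have h3 := (hp.mul h1).const_mul m⁻¹
    rw [mul_zero, mul_zero] at h3
    refine h3.congr fun i => ?_
    have : (N i : ℂ) = (√(N i : ℝ) : ℂ) * (√(N i : ℝ) : ℂ) := by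
      rw [← ofReal_mul, Real.mul_self_sqrt (Nat.cast_nonneg _), ofReal_natCast]
    rw [this]
    simp only [div_eq_mul_inv, mul_inv]
    ring
  simpa using (h2.const_add 1).const_mul ξ

/-- The linear term of `N * saddle` is exactly `p`, and the quadratic error is `O(|p|² / N)`, which
is why `p = o(√N)` is the right hypothesis. The value at `ξ` contributes `-iτN / λ`. -/
theorem tendsto_saddle (hN : Tendsto N L atTop)
    (hp : Tendsto (fun i => p i / √(N i : ℝ)) L (𝓝 0)) {lam : ℝ} (hlam : 0 < lam) {ξ : ℂ}
    (hξ : ξ ∈ limitCurve lam) (hslit : ξ ∈ slitPlane) (hm : 1 - ξ ^ (lam : ℂ) ≠ 0) {z : ι → ℂ}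
    (hz : ∀ i, z i = ξ * (1 + p i / ((1 - ξ ^ (lam : ℂ)) * N i))) :
    Tendsto (fun i => z i ^ N i * exp (N i / lam * (1 - z i ^ (lam : ℂ))) *
      exp (-(p i - I * (tau lam ξ * N i / lam : ℝ)))) L (𝓝 1) := by
  have hl : (lam : ℂ) ≠ 0 := ofReal_ne_zero.2 hlam.ne'
  have h0 := slitPlane_ne_zero hslit
  have hzξ : Tendsto z L (𝓝 ξ) :=
    (tendsto_scaled hN hp ξ (1 - ξ ^ (lam : ℂ))).congr fun i => (hz i).symm
  set y : ι → ℂ := fun i => z i - ξ with hy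
  have hy0 : Tendsto y L (𝓝 0) := by simpa using hzξ.sub_const ξ
  have hO := (saddle_isBigO hlam.ne' hslit).comp_tendsto hy0
  have hn0 : ∀ᶠ i in L, (N i : ℝ) ≠ 0 := by
    filter_upwards [hN.eventually_ge_atTop 1] with i hi
    exact_mod_cast Nat.one_le_iff_ne_zero.1 hi
  have hE : Tendsto (fun i => (N i : ℂ) * (saddle lam (ξ + y i) - saddle lam ξ -
      (1 - ξ ^ (lam : ℂ)) / ξ * y i)) L (𝓝 0) := by
    have h1 : (fun i => (N i : ℂ) * (saddle lam (ξ + y i) - saddle lam ξ -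
      (1 - ξ ^ (lam : ℂ)) / ξ * y i)) =O[L] fun i => (N i : ℂ) * (‖y i‖ ^ 2 : ℝ) := by
      refine (isBigO_refl _ _).mul ?_
      refine hO.trans (isBigO_of_le _ fun i => ?_)
      simp
    refine h1.trans_tendsto ?_
    have h2 : Tendsto (fun i => ((‖ξ / (1 - ξ ^ (lam : ℂ))‖ ^ 2 * ‖p i / √(N i : ℝ)‖ ^ 2 : ℝ) : ℂ))
        L (𝓝 0) := by
      have h3 := ((hp.norm.pow 2).const_mul (‖ξ / (1 - ξ ^ (lam : ℂ))‖ ^ 2))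
      have h4 := (continuous_ofReal.tendsto _).comp h3
      simpa [Function.comp_def] using h4
    refine h2.congr' ?_
    filter_upwards [hn0] with i hi
    have hyi : y i = ξ / (1 - ξ ^ (lam : ℂ)) * (p i / N i) := by
      simp only [hy, hz i]
      have : (N i : ℂ) ≠ 0 := by exact_mod_cast hi
      field_simp
      ring
    have hsq : √(N i : ℝ) ^ 2 = N i := Real.sq_sqrt (Nat.cast_nonneg _)
    rw [hyi, norm_mul, norm_div (p i), norm_div (p i), Complex.norm_natCast, norm_real,
      Real.norm_of_nonneg (Real.sqrt_nonneg _), ← ofReal_natCast, ← ofReal_mul]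
    congr 1
    rw [mul_pow, div_pow, hsq, div_pow]
    field_simp
  have hexp := (continuous_exp.tendsto 0).comp hE
  rw [Complex.exp_zero] at hexp
  refine hexp.congr' ?_
  filter_upwards [hn0, hzξ.eventually_ne h0] with i hi hzi
  have hi' : (N i : ℂ) ≠ 0 := by exact_mod_cast hi
  have hτ := eq_tau_mul_I_of_mem_limitCurve hlam hξ
  have hyi : (1 - ξ ^ (lam : ℂ)) / ξ * y i = p i / N i := by
    simp only [hy, hz i]
    field_simp
    ring
  have hpow : z i ^ N i = exp (N i * log (z i)) := by
    rw [exp_nat_mul, exp_log hzi]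
  simp only [Function.comp]
  rw [hyi, show ξ + y i = z i by simp [hy], hpow, ← exp_add, ← exp_add]
  congr 1
  simp only [saddle]
  have hlog : log ξ = (ξ ^ (lam : ℂ) - 1 - tau lam ξ * I) / lam := by
    rw [← hτ]; field_simp; ring
  rw [hlog]
  push_cast
  field_simp
  ring

end scaling

/-! ### Asymptotics of the remainder integral -/

section remainder

variable {ι : Type*} {L : Filter ι} {N : ι → ℕ} {z : ι → ℂ} {ξ ζ a b A : ℂ}
  {lam μ θ : ℝ} {f : ℂ → ℂ}

theorem continuous_remainderKernel (hf : Continuous f) (r : ℝ) (n : ℕ) {v : ℂ} (hv : ‖v‖ < 1) :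
    Continuous fun t : ℝ => remainderKernel f r n v (exp (t * I)) := by
  have h1 : Continuous fun t : ℝ => (exp (t * I) ^ n)⁻¹ :=
    Continuous.inv₀ (by fun_prop) fun t => pow_ne_zero _ (exp_ne_zero _)
  have h2 : Continuous fun t : ℝ => exp (t * I) / (exp (t * I) - v) :=
    Continuous.div (by fun_prop) (by fun_prop) fun t =>
      sub_ne_zero_of_norm_lt (norm_exp_ofReal_mul_I t) hv
  have h3 : Continuous fun t : ℝ => f (r * exp (t * I)) := by fun_prop
  exact (h3.mul h1).mul h2

theorem isEquivalent_comp_mul (hζ : ‖ζ‖ = 1)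
    (h : IsEquivalent (cobounded ℂ ⊓ 𝓟 (sector ζ θ)) f
      (fun z => A * (z / ζ) ^ b * exp ((z / ζ) ^ (lam : ℂ)))) :
    IsEquivalent (cobounded ℂ ⊓ 𝓟 (sector 1 θ)) (fun z => f (ζ * z))
      (fun z => A * z ^ b * exp (z ^ (lam : ℂ))) := by
  have hζ0 : ζ ≠ 0 := norm_ne_zero_iff.1 (by rw [hζ]; exact one_ne_zero)
  have ht : Tendsto (fun z => ζ * z) (cobounded ℂ ⊓ 𝓟 (sector 1 θ))
      (cobounded ℂ ⊓ 𝓟 (sector ζ θ)) := by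
    refine tendsto_inf.2 ⟨?_, tendsto_principal.2 ?_⟩
    · refine Tendsto.mono_left ?_ inf_le_left
      rw [← tendsto_norm_atTop_iff_cobounded]
      simpa [hζ] using tendsto_norm_cobounded_atTop (E := ℂ)
    · filter_upwards [mem_inf_of_right (mem_principal_self _)] with u hu
      exact (mul_mem_sector_self hζ0 u).2 hu
  have := h.comp_tendsto ht
  refine this.congr_right (Eventually.of_forall fun u => ?_)
  simp [hζ0]

theorem tendsto_sqrt_mul_radius_rpow_mul_exp (hN : Tendsto N L atTop) (hlam : 0 < lam)
    (hμ : μ < 1) (α : ℝ) :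
    Tendsto (fun i => √(N i : ℝ) * radius lam (N i) ^ α * Real.exp (-((1 - μ) * (N i / lam)))) L
      (𝓝 0) := by
  have hx : Tendsto (fun i => (N i : ℝ) / lam) L atTop :=
    (tendsto_natCast_atTop_atTop.comp hN).atTop_div_const hlam
  -- In the variable `x = N / λ`, the prefactor `√N * r ^ α` equals `√λ * x ^ (1/2 + α/λ)`.
  have h := ((tendsto_rpow_mul_exp_neg_mul_atTop_nhds_zero (1 / 2 + α / lam) (1 - μ)
    (by linarith)).comp hx).const_mul √lam
  rw [mul_zero] at h
  refine h.congr' ?_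
  filter_upwards [hN.eventually_ge_atTop 1] with i hi
  have hn : (0 : ℝ) < N i := by exact_mod_cast hi
  have hd : 0 < (N i : ℝ) / lam := by positivity
  simp only [Function.comp]
  rw [radius, ← Real.rpow_mul hd.le, Real.rpow_add hd, ← Real.sqrt_eq_rpow,
    Real.sqrt_div hn.le, one_div_mul_eq_div, neg_mul]
  have : √lam ≠ 0 := (Real.sqrt_pos.2 hlam).ne'
  field_simp

/-- On the circle of radius `r` the growth bound is `exp (μ n / λ)`, which loses to the
normalisation `exp (-n / λ)` because `μ < 1`. -/
theorem tendsto_integral_rest (hN : Tendsto N L atTop) (hlam : 0 < lam)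
    (hμ : μ < 1) {S : Set ℂ} (hS : ∀ (r : ℝ) (u : ℂ), 0 < r → u ∈ S → (r : ℂ) * u ∈ S)
    (hO : IsBigO (cobounded ℂ ⊓ 𝓟 S) f (fun z => Real.exp (μ * ‖z‖ ^ lam)))
    (hz : Tendsto z L (𝓝 ξ)) (hξ : ‖ξ‖ < 1) (a : ℂ) :
    Tendsto (fun i => (√(N i : ℝ) : ℂ) * (exp (-(N i / lam)) * (radius lam (N i) : ℂ) ^ (-a) *
      ∫ t in -Real.pi..Real.pi,
        S.indicator (remainderKernel f (radius lam (N i)) (N i) (z i)) (exp (t * I)))) L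
      (𝓝 0) := by
  obtain ⟨C, hC0, hC⟩ := hO.exists_pos
  obtain ⟨R, hR⟩ : ∃ R : ℝ, ∀ v : ℂ, R ≤ ‖v‖ → v ∈ S → ‖f v‖ ≤ C * Real.exp (μ * ‖v‖ ^ lam) := by
    have h := hC.bound
    rw [eventually_inf_principal, ← comap_norm_atTop, eventually_comap] at h
    obtain ⟨R, hR⟩ := eventually_atTop.1 h
    exact ⟨R, fun v hv hs => by simpa using hR _ hv v rfl hs⟩
  have hrad : Tendsto (fun i => radius lam (N i)) L atTop := (tendsto_radius hlam).comp hN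
  set ρ := (1 + ‖ξ‖) / 2 with hρ
  have hρ1 : ρ < 1 := by linarith
  have hzρ : ∀ᶠ i in L, ‖z i‖ ≤ ρ := hz.norm.eventually_le_const (by linarith)
  have hlim := (tendsto_sqrt_mul_radius_rpow_mul_exp hN hlam hμ (-a.re)).const_mul
    (C * (1 - ρ)⁻¹ * (2 * Real.pi))
  rw [mul_zero] at hlim
  refine squeeze_zero_norm' ?_ hlim
  filter_upwards [hzρ, hrad.eventually_ge_atTop R, hN.eventually_ge_atTop 1] with i hzi hi hi1
  have hr := radius_pos hlam (Nat.one_le_iff_ne_zero.1 hi1)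
  have hρ0 : 0 < 1 - ρ := by linarith
  have hbound : ∀ t ∈ Set.uIoc (-Real.pi) Real.pi,
      ‖S.indicator (remainderKernel f (radius lam (N i)) (N i) (z i)) (exp (t * I))‖ ≤
        C * Real.exp (μ * (N i / lam)) * (1 - ρ)⁻¹ := by
    intro t _
    by_cases ht : exp (t * I) ∈ S
    · rw [Set.indicator_of_mem ht, remainderKernel, norm_mul, norm_mul, norm_inv, norm_pow,
        norm_exp_ofReal_mul_I, one_pow, inv_one, mul_one]
      have hnorm : ‖(radius lam (N i) : ℂ) * exp (t * I)‖ = radius lam (N i) := by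
        rw [norm_mul, norm_exp_ofReal_mul_I, mul_one, norm_real, Real.norm_of_nonneg hr.le]
      have h1 := hR _ (by rw [hnorm]; exact hi) (hS _ _ hr ht)
      rw [hnorm, radius_rpow hlam] at h1
      have h2 := norm_kernel_le norm_one (norm_exp_ofReal_mul_I t) hρ1 hzi
      rw [one_mul] at h2
      gcongr
    · rw [Set.indicator_of_notMem ht, norm_zero]
      positivity
  have hint := intervalIntegral.norm_integral_le_of_norm_le_const hbound
  rw [sub_neg_eq_add, ← two_mul, abs_of_pos Real.two_pi_pos] at hint
  have hexp : ‖exp (-(N i / lam : ℂ))‖ = Real.exp (-(N i / lam)) := by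
    rw [← ofReal_natCast, ← ofReal_div, ← ofReal_neg, ← ofReal_exp, norm_real,
      Real.norm_of_nonneg (Real.exp_pos _).le]
  rw [norm_mul, norm_mul, norm_mul, hexp, norm_real, Real.norm_of_nonneg (Real.sqrt_nonneg _),
    norm_cpow_eq_rpow_re_of_pos hr, neg_re]
  calc _ ≤ √(N i : ℝ) * (Real.exp (-(N i / lam)) * radius lam (N i) ^ (-a.re) *
        (C * Real.exp (μ * (N i / lam)) * (1 - ρ)⁻¹ * (2 * Real.pi))) := by gcongr
    _ = C * (1 - ρ)⁻¹ * (2 * Real.pi) * (√(N i : ℝ) * radius lam (N i) ^ (-a.re) *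
        (Real.exp (-(N i / lam)) * Real.exp (μ * (N i / lam)))) := by ring
    _ = _ := by
        rw [← Real.exp_add]
        congr 4
        ring

end remainder

section ratio

variable {ι : Type*} {L : Filter ι} [L.IsCountablyGenerated] {N : ι → ℕ} {z : ι → ℂ}
  {ξ ζ a b A : ℂ} {lam μ θ : ℝ} {f : ℂ → ℂ}

/-- The factor `r ^ (b - a) ζ ^ (-n)` is kept explicit because it may decay, grow or oscillate. Only
the coefficients `S` and `T` have limits in every case. -/
theorem exists_tendsto_integral_remainderKernel (hf : Continuous f) (hlam : 0 < lam) (hμ : μ < 1)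
    (hζ : ‖ζ‖ = 1) (hθ0 : 0 < θ) (hθπ : θ < Real.pi) (hθlam : lam * θ < 2 * Real.pi)
    (hdisj : Disjoint (sector 1 θ) (sector ζ θ)) (hgrowth : TwoDirectionGrowth f a b A lam μ ζ θ)
    (hN : Tendsto N L atTop) (hz : Tendsto z L (𝓝 ξ)) (hξ : ‖ξ‖ < 1) :
    ∃ S T : ι → ℂ, Tendsto S L (𝓝 (1 / (1 - ξ) * (√(2 * Real.pi / lam) : ℝ))) ∧
      Tendsto T L (𝓝 (A * (ζ / (ζ - ξ)) * (√(2 * Real.pi / lam) : ℝ))) ∧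
      ∀ᶠ i in L, (√(N i : ℝ) : ℂ) * (exp (-(N i / lam)) * (radius lam (N i) : ℂ) ^ (-a) *
        ∫ t in (0 : ℝ)..2 * Real.pi,
          remainderKernel f (radius lam (N i)) (N i) (z i) (exp (t * I))) =
        S i + (radius lam (N i) : ℂ) ^ (b - a) * (ζ ^ N i)⁻¹ * T i := by
  have hζ0 : ζ ≠ 0 := norm_ne_zero_iff.1 (by rw [hζ]; exact one_ne_zero)
  have hfirst : IsEquivalent (cobounded ℂ ⊓ 𝓟 (sector 1 θ)) f
      (fun z => 1 * z ^ a * exp (z ^ (lam : ℂ))) := by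
    simpa only [one_mul] using hgrowth.first
  have h1 := tendsto_laplace hN hf hlam hθ0 hθπ hθlam hfirst norm_one hz hξ
  have h2 := tendsto_laplace hN (g := fun u => f (ζ * u)) (by fun_prop) hlam hθ0 hθπ hθlam
    (isEquivalent_comp_mul hζ hgrowth.second) hζ hz hξ
  have h3 := tendsto_integral_rest hN hlam hμ (S := (sector 1 θ ∪ sector ζ θ)ᶜ)
    (fun r u hr hu h => hu (h.imp (mul_mem_sector hr u).1 (mul_mem_sector hr u).1))
    hgrowth.rest hz hξ a
  have h13 := h1.add h3
  rw [add_zero, one_mul] at h13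
  -- The negligible third piece is absorbed into `S`.
  refine ⟨_, _, h13, h2, ?_⟩
  filter_upwards [hN.eventually_ge_atTop 1, hz.norm.eventually_lt_const hξ] with i hi hzi
  have hr := radius_pos hlam (Nat.one_le_iff_ne_zero.1 hi)
  have hr' : (radius lam (N i) : ℂ) ≠ 0 := ofReal_ne_zero.2 hr.ne'
  rw [integral_circle_eq_add hζ hθ0 hθπ hdisj
    (continuous_remainderKernel hf (radius lam (N i)) (N i) hzi)]
  have e1 : ∀ t : ℝ, f (radius lam (N i) * exp (t * I)) * (exp (t * I) ^ N i)⁻¹ *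
      (1 * exp (t * I) / (1 * exp (t * I) - z i)) =
      remainderKernel f (radius lam (N i)) (N i) (z i) (exp (t * I)) := fun t => by
    rw [remainderKernel, one_mul]
  have e2 : ∀ t : ℝ, remainderKernel f (radius lam (N i)) (N i) (z i) (ζ * exp (t * I)) =
      (ζ ^ N i)⁻¹ * (f (ζ * (radius lam (N i) * exp (t * I))) * (exp (t * I) ^ N i)⁻¹ *
      (ζ * exp (t * I) / (ζ * exp (t * I) - z i))) := fun t => by
    rw [remainderKernel, mul_pow, mul_inv, mul_left_comm ζ]
    ring
  have hb : (radius lam (N i) : ℂ) ^ (-a) =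
      (radius lam (N i) : ℂ) ^ (b - a) * (radius lam (N i) : ℂ) ^ (-b) := by
    rw [← cpow_add _ _ hr']
    congr 1
    ring
  simp only [e1, e2, intervalIntegral.integral_const_mul]
  rw [hb]
  ring

end ratio

/-! ### The quotient for a general scaling -/

section ratio

variable {ι : Type*} {L : Filter ι} [L.IsCountablyGenerated] {N : ι → ℕ} {z p : ι → ℂ}
  {ξ ζ a b A : ℂ} {lam μ θ : ℝ} {f : ℂ → ℂ}

/-- All three cases of the theorem come from this one formula by the choice of `p`. Division by `f
(r z)` is legitimate because `r z` eventually lies in the sector around `1`, where `f` is a factor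
tending to `1` times a nonvanishing model. -/
theorem exists_ratio_eq (hf : Differentiable ℂ f) (hlam : 0 < lam) (hμ : μ < 1)
    (hζ : ‖ζ‖ = 1) (hθ0 : 0 < θ) (hθπ : θ < Real.pi) (hθlam : lam * θ < 2 * Real.pi)
    (hdisj : Disjoint (sector 1 θ) (sector ζ θ)) (hgrowth : TwoDirectionGrowth f a b A lam μ ζ θ)
    (hξ : ξ ∈ limitCurve lam) (hξθ : |ξ.arg| < θ) (hξ1 : ξ ≠ 1)
    (hN : Tendsto N L atTop) (hp : Tendsto (fun i => p i / √(N i : ℝ)) L (𝓝 0))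
    (hz : ∀ i, z i = ξ * (1 + p i / ((1 - ξ ^ (lam : ℂ)) * N i))) :
    ∃ S T : ι → ℂ, Tendsto S L (𝓝 (1 / (1 - ξ) / (ξ ^ a * (√(2 * Real.pi * lam) : ℝ)))) ∧
      Tendsto T L (𝓝 (A * (ζ / (ζ - ξ)) / (ξ ^ a * (√(2 * Real.pi * lam) : ℝ)))) ∧
      ∀ᶠ i in L, f (radius lam (N i) * z i) ≠ 0 ∧
        ratio f lam (N i) (z i) =
          1 - exp (p i - I * (tau lam ξ * N i / lam : ℝ)) / (√(N i : ℝ) : ℂ) *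
            (S i + (radius lam (N i) : ℂ) ^ (b - a) * (ζ ^ N i)⁻¹ * T i) := by
  have h0 := ne_zero_of_mem_limitCurve hlam hξ
  have hnorm := norm_lt_one_of_mem_limitCurve hlam hθlam hξ hξθ hξ1
  have hm := one_sub_cpow_ne_zero hlam hnorm
  have hslit : ξ ∈ slitPlane := by
    rw [mem_slitPlane_iff_arg]
    exact ⟨fun h => by rw [h, abs_of_pos Real.pi_pos] at hξθ; linarith, h0⟩
  have hzξ : Tendsto z L (𝓝 ξ) :=
    (tendsto_scaled hN hp ξ (1 - ξ ^ (lam : ℂ))).congr fun i => (hz i).symm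
  obtain ⟨S, T, hS, hT, hST⟩ := exists_tendsto_integral_remainderKernel hf.continuous hlam hμ hζ
    hθ0 hθπ hθlam hdisj hgrowth hN hzξ hnorm
  obtain ⟨φ, hφ, hfφ⟩ := hgrowth.first.exists_eq_mul
  have hrad : Tendsto (fun i => radius lam (N i)) L atTop := (tendsto_radius hlam).comp hN
  have hlarge : Tendsto (fun i => (radius lam (N i) : ℂ) * z i) L
      (cobounded ℂ ⊓ 𝓟 (sector 1 θ)) := by
    refine tendsto_inf.2 ⟨?_, tendsto_principal.2 ?_⟩
    · rw [← tendsto_norm_atTop_iff_cobounded]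
      refine (hrad.atTop_mul_pos (norm_pos_iff.2 h0) hzξ.norm).congr' ?_
      filter_upwards [hrad.eventually_ge_atTop 0] with i hi
      rw [norm_mul, norm_real, Real.norm_of_nonneg hi]
    · have harg : Tendsto (fun i => |(z i).arg|) L (𝓝 |ξ.arg|) :=
        ((continuousAt_arg hslit).tendsto.comp hzξ).abs
      filter_upwards [hrad.eventually_gt_atTop 0, harg.eventually_le_const hξθ,
        hzξ.eventually_ne h0] with i hi harg hzi
      refine (mul_mem_sector hi _).2 ⟨hzi, ?_⟩
      rwa [div_one]
  have hφ1 := hφ.comp hlarge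
  have hfeq := hlarge.eventually hfφ
  have hza : Tendsto (fun i => z i ^ a) L (𝓝 (ξ ^ a)) :=
    (continuousAt_cpow_const hslit).tendsto.comp hzξ
  have hξa : ξ ^ a ≠ 0 := by simp [cpow_eq_zero_iff, h0]
  have hsad := tendsto_saddle hN hp hlam hξ hslit hm hz
  have hden : Tendsto (fun i => 2 * Real.pi * (z i ^ a) * φ (radius lam (N i) * z i)) L
      (𝓝 (2 * Real.pi * ξ ^ a * 1)) := (hza.const_mul _).mul hφ1
  have hπ : (Real.pi : ℂ) ≠ 0 := ofReal_ne_zero.2 Real.pi_ne_zero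
  have hden0 : 2 * Real.pi * ξ ^ a * 1 ≠ 0 := by simp [hπ, hξa]
  -- This quotient, with limit `1 / (2π ξ ^ a)`, is the common factor multiplying both peaks.
  have hκ := hsad.div hden hden0
  have hsqrt : ((√(2 * Real.pi / lam) : ℝ) : ℂ) / (2 * Real.pi) =
      1 / ((√(2 * Real.pi * lam) : ℝ) : ℂ) := by
    have h : √(2 * Real.pi / lam) * √(2 * Real.pi * lam) = 2 * Real.pi := by
      rw [← Real.sqrt_mul (by positivity), show 2 * Real.pi / lam * (2 * Real.pi * lam) =
        (2 * Real.pi) * (2 * Real.pi) by field_simp, Real.sqrt_mul_self (by positivity)]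
    have h' : ((√(2 * Real.pi * lam) : ℝ) : ℂ) ≠ 0 :=
      ofReal_ne_zero.2 (Real.sqrt_pos.2 (by positivity)).ne'
    rw [div_eq_div_iff (by simp [hπ]) h', ← ofReal_mul, h]
    push_cast; ring
  have hS' := hκ.mul hS
  have hT' := hκ.mul hT
  have hrw : ∀ x : ℂ, 1 / (2 * Real.pi * ξ ^ a * 1) * (x * (√(2 * Real.pi / lam) : ℝ)) =
      x / (ξ ^ a * (√(2 * Real.pi * lam) : ℝ)) := fun x => by
    rw [show 1 / (2 * Real.pi * ξ ^ a * 1) * (x * ((√(2 * Real.pi / lam) : ℝ) : ℂ)) =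
      x / ξ ^ a * (((√(2 * Real.pi / lam) : ℝ) : ℂ) / (2 * Real.pi)) by field_simp, hsqrt]
    field_simp
  rw [hrw] at hS' hT'
  refine ⟨_, _, hS', hT', ?_⟩
  filter_upwards [hST, hfeq, hφ1.eventually_ne one_ne_zero, hN.eventually_ge_atTop 1,
    hzξ.eventually_ne h0, hzξ.norm.eventually_lt_const hnorm] with i hi hfi hφi hi1 hzi hzi1
  have hn : N i ≠ 0 := Nat.one_le_iff_ne_zero.1 hi1
  have hr := radius_pos hlam hn
  have hr' : (radius lam (N i) : ℂ) ≠ 0 := ofReal_ne_zero.2 hr.ne'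
  have hsq : (√(N i : ℝ) : ℂ) ≠ 0 :=
    ofReal_ne_zero.2 (Real.sqrt_pos.2 (Nat.cast_pos.2 hi1)).ne'
  have hzia : z i ^ a ≠ 0 := by simp [cpow_eq_zero_iff, hzi]
  have hria : (radius lam (N i) : ℂ) ^ a ≠ 0 := by simp [cpow_eq_zero_iff, hr']
  simp only [Pi.mul_apply, Function.comp] at hfi hφi
  rw [radius_mul_cpow hlam hn hzi, cpow_ofReal_mul hr hzi] at hfi
  have hf0 : f (radius lam (N i) * z i) ≠ 0 := by
    rw [hfi]
    exact mul_ne_zero hφi (mul_ne_zero (mul_ne_zero hria hzia) (exp_ne_zero _))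
  refine ⟨hf0, ?_⟩
  have hrem := sub_partialSum_eq hf hr hn hzi1
  have hratio : ratio f lam (N i) (z i) = 1 - (f (radius lam (N i) * z i) -
      partialSum f (N i - 1) (radius lam (N i) * z i)) / f (radius lam (N i) * z i) := by
    rw [ratio, sub_div, div_self hf0]; ring
  rw [hratio, hrem, hfi]
  congr 1
  simp only [Pi.div_apply]
  have hexp1 : exp (N i / lam * (1 - z i ^ (lam : ℂ))) =
      exp (N i / lam) * (exp (N i / lam * z i ^ (lam : ℂ)))⁻¹ := by
    rw [← exp_neg, ← exp_add]; congr 1; ring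
  rw [cpow_neg, exp_neg] at hi
  rw [exp_neg, hexp1]
  set J := ∫ t in (0 : ℝ)..2 * Real.pi,
    remainderKernel f (radius lam (N i)) (N i) (z i) (exp (t * I)) with hJ
  have e1 := exp_ne_zero (N i / lam * z i ^ (lam : ℂ))
  have e2 := exp_ne_zero (N i / lam : ℂ)
  have e3 := exp_ne_zero (p i - I * (tau lam ξ * N i / lam : ℝ))
  have hJ' : J = exp (N i / lam) * (radius lam (N i) : ℂ) ^ a / (√(N i : ℝ) : ℂ) *
      (S i + (radius lam (N i) : ℂ) ^ (b - a) * (ζ ^ N i)⁻¹ * T i) := by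
    rw [← hi]
    field_simp
  rw [hJ']
  generalize (radius lam (N i) : ℂ) ^ (b - a) * (ζ ^ N i)⁻¹ = q
  field_simp

end ratio

/-! ### Uniform convergence as a joint limit -/

section uniform

variable {K : Set ℂ}

theorem tendstoUniformlyOn_iff_tendsto_sub {F : ℕ → ℂ → ℂ} {G : ℂ → ℂ} :
    TendstoUniformlyOn F G atTop K ↔
      Tendsto (fun q : ℕ × ℂ => F q.1 q.2 - G q.2) (atTop ×ˢ 𝓟 K) (𝓝 0) := by
  rw [Metric.tendstoUniformlyOn_iff, Metric.tendsto_nhds]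
  simp only [eventually_prod_principal_iff, dist_comm (G _), dist_eq_norm, sub_zero]

theorem isBoundedUnder_snd (hK : IsCompact K) (F : ℂ → ℂ) (hF : Continuous F) :
    IsBoundedUnder (· ≤ ·) ((atTop : Filter ℕ) ×ˢ 𝓟 K) (fun q => ‖F q.2‖) := by
  obtain ⟨C, hC⟩ := hK.exists_bound_of_continuousOn hF.continuousOn
  refine isBoundedUnder_of_eventually_le (a := C) ?_
  rw [eventually_prod_principal_iff]
  exact Eventually.of_forall fun n w hw => hC w hw

end uniform

/-! ### Logarithmic scaling variables -/

section scaling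

variable {ι : Type*} {L : Filter ι} {N : ι → ℕ}

/-- Both scalings have a displacement `p` of this form, with `w` in a compact set and the angle
representatives bounded by `π`; this verifies `p = o(√n)`. -/
theorem tendsto_log_add_bounded_div_sqrt (hN : Tendsto N L atTop) (c : ℂ) {B : ι → ℂ}
    (hB : IsBoundedUnder (· ≤ ·) L fun i => ‖B i‖) :
    Tendsto (fun i => (c * Real.log (N i) + B i) / (√(N i : ℝ) : ℂ)) L (𝓝 0) := by
  have h1 : Tendsto (fun i => Real.log (N i) / √(N i : ℝ)) L (𝓝 0) := by
    have := (isLittleO_log_rpow_atTop (one_half_pos (α := ℝ))).tendsto_div_nhds_zero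
    simp only [← Real.sqrt_eq_rpow] at this
    exact this.comp (tendsto_natCast_atTop_atTop.comp hN)
  have h2 : Tendsto (fun i => ((√(N i : ℝ))⁻¹ : ℂ)) L (𝓝 0) := by
    have := (continuous_ofReal.tendsto 0).comp (tendsto_sqrt_natCast hN).inv_tendsto_atTop
    simpa [Function.comp_def] using this
  have h3 := ((continuous_ofReal.tendsto 0).comp h1).const_mul c
  have h4 := h3.add (h2.zero_mul_isBoundedUnder_le hB)
  simp only [ofReal_zero, mul_zero, add_zero, Function.comp_def] at h4
  refine h4.congr fun i => ?_
  push_cast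
  ring

theorem tendsto_cpow_zero {x : ι → ℝ} (hx : Tendsto x L atTop) {s : ℂ} (hs : s.re < 0) :
    Tendsto (fun i => (x i : ℂ) ^ s) L (𝓝 0) := by
  have h := (tendsto_rpow_neg_atTop (neg_pos.2 hs)).comp hx
  rw [neg_neg] at h
  rw [tendsto_zero_iff_norm_tendsto_zero]
  refine h.congr' ?_
  filter_upwards [hx.eventually_gt_atTop 0] with i hi
  rw [Function.comp, norm_cpow_eq_rpow_re_of_pos hi]

end scaling

theorem zOne_eq (lam : ℝ) (ξ : ℂ) (n : ℕ) (w : ℂ) :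
    zOne lam ξ n w = ξ * (1 + (1 / 2 * Real.log n + (-w + I * tauSeq lam ξ n)) /
      ((1 - ξ ^ (lam : ℂ)) * n)) := by
  rw [zOne]
  generalize 1 - ξ ^ (lam : ℂ) = m
  ring

theorem zTwo_eq {lam : ℝ} (hlam : 0 < lam) (a b ζ ξ : ℂ) (n : ℕ) (w : ℂ) :
    zTwo a b lam ζ ξ n w = ξ * (1 + (((a - b) / lam + 1 / 2) * Real.log n +
      (-w + I * sigmaSeq ζ n + I * tauSeq lam ξ n)) / ((1 - ξ ^ (lam : ℂ)) * n)) := by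
  have hl : (lam : ℂ) ≠ 0 := ofReal_ne_zero.2 hlam.ne'
  rw [zTwo, show (a - b) / lam + 1 / 2 = (a - b + lam / 2) / lam by field_simp]
  generalize 1 - ξ ^ (lam : ℂ) = m
  ring

theorem exp_I_mul_tauSeq (lam : ℝ) (ξ : ℂ) (n : ℕ) :
    exp (I * tauSeq lam ξ n) = exp (I * (tau lam ξ * n / lam : ℝ)) := by
  rw [tauSeq, mul_comm, exp_angleRep_mul_I, mul_comm]

theorem exp_I_mul_sigmaSeq {ζ : ℂ} (hζ : ‖ζ‖ = 1) (n : ℕ) :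
    exp (I * sigmaSeq ζ n) = ζ ^ n := by
  rw [sigmaSeq, mul_comm, exp_angleRep_mul_I]
  conv_rhs => rw [← norm_mul_exp_arg_mul_I ζ, hζ, ofReal_one, one_mul, ← exp_nat_mul]
  push_cast
  ring_nf

theorem exp_half_log {n : ℕ} (hn : n ≠ 0) :
    exp (1 / 2 * Real.log n) = (√(n : ℝ) : ℂ) := by
  have hn' : (0 : ℝ) < n := Nat.cast_pos.2 (Nat.pos_of_ne_zero hn)
  rw [Real.sqrt_eq_rpow, Real.rpow_def_of_pos hn', ofReal_exp]
  push_cast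
  ring_nf

theorem natCast_cpow_eq_exp {n : ℕ} (hn : n ≠ 0) (s : ℂ) :
    ((n : ℝ) : ℂ) ^ s = exp (s * Real.log n) := by
  rw [cpow_def_of_ne_zero (by simpa using hn), ofReal_log (Nat.cast_nonneg _), mul_comm]

theorem radius_cpow {lam : ℝ} (hlam : 0 < lam) {n : ℕ} (hn : n ≠ 0) (s : ℂ) :
    (radius lam n : ℂ) ^ s = ((n : ℝ) : ℂ) ^ (s / lam) * (lam : ℂ) ^ (-s / lam) := by
  have hn' : (0 : ℝ) < n := Nat.cast_pos.2 (Nat.pos_of_ne_zero hn)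
  have hr := radius_pos hlam hn
  rw [natCast_cpow_eq_exp hn, cpow_def_of_ne_zero (ofReal_ne_zero.2 hr.ne'), ← ofReal_log hr.le,
    cpow_def_of_ne_zero (ofReal_ne_zero.2 hlam.ne'), ← ofReal_log hlam.le, ← exp_add, radius,
    Real.log_rpow (by positivity), Real.log_div hn'.ne' hlam.ne']
  congr 1
  push_cast
  ring

/-! ### The quotient in the two scalings -/

section main

variable {f : ℂ → ℂ} {a b A ζ ξ : ℂ} {lam μ θ : ℝ} {K : Set ℂ}

/-- Here `exp p = √n e^{-w} e^{iτn/λ}`: the half logarithm cancels `1 / √n` and `tauSeq` cancels the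
rotation. -/
theorem exists_ratio_zOne_eq (hf : Differentiable ℂ f) (hlam : 0 < lam) (hμ : μ < 1)
    (hζ : ‖ζ‖ = 1) (hθ0 : 0 < θ) (hθπ : θ < Real.pi) (hθlam : lam * θ < 2 * Real.pi)
    (hdisj : Disjoint (sector 1 θ) (sector ζ θ)) (hgrowth : TwoDirectionGrowth f a b A lam μ ζ θ)
    (hξ : ξ ∈ limitCurve lam) (hξθ : |ξ.arg| < θ) (hξ1 : ξ ≠ 1) (hK : IsCompact K) :
    ∃ S T : ℕ × ℂ → ℂ,
      Tendsto S (atTop ×ˢ 𝓟 K) (𝓝 (1 / (1 - ξ) / (ξ ^ a * (√(2 * Real.pi * lam) : ℝ)))) ∧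
      Tendsto T (atTop ×ˢ 𝓟 K)
        (𝓝 (A * (ζ / (ζ - ξ)) / (ξ ^ a * (√(2 * Real.pi * lam) : ℝ)))) ∧
      ∀ᶠ q in atTop ×ˢ 𝓟 K, f (radius lam q.1 * zOne lam ξ q.1 q.2) ≠ 0 ∧
        ratio f lam q.1 (zOne lam ξ q.1 q.2) = 1 - exp (-q.2) *
          (S q + (radius lam q.1 : ℂ) ^ (b - a) * (ζ ^ q.1)⁻¹ * T q) := by
  have hN : Tendsto (fun q : ℕ × ℂ => q.1) (atTop ×ˢ 𝓟 K) atTop := tendsto_fst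
  obtain ⟨C, hC⟩ := hK.exists_bound_of_continuousOn (f := fun w : ℂ => w) continuousOn_id
  have hB : IsBoundedUnder (· ≤ ·) (atTop ×ˢ 𝓟 K)
      (fun q : ℕ × ℂ => ‖-q.2 + I * tauSeq lam ξ q.1‖) := by
    refine isBoundedUnder_of_eventually_le (a := C + Real.pi) ?_
    rw [eventually_prod_principal_iff]
    refine Eventually.of_forall fun n w hw => (norm_add_le _ _).trans ?_
    rw [norm_neg, norm_mul, norm_I, one_mul, norm_real]
    exact add_le_add (hC w hw) (abs_angleRep_le _)
  obtain ⟨S, T, hS, hT, h⟩ := exists_ratio_eq hf hlam hμ hζ hθ0 hθπ hθlam hdisj hgrowth hξ hξθ hξ1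
    hN (tendsto_log_add_bounded_div_sqrt hN (1 / 2) hB) fun q => zOne_eq lam ξ q.1 q.2
  refine ⟨S, T, hS, hT, ?_⟩
  filter_upwards [h, hN.eventually_ge_atTop 1] with q hq hq1
  refine ⟨hq.1, ?_⟩
  have hn : q.1 ≠ 0 := Nat.one_le_iff_ne_zero.1 hq1
  have hsq : (√(q.1 : ℝ) : ℂ) ≠ 0 :=
    ofReal_ne_zero.2 (Real.sqrt_pos.2 (Nat.cast_pos.2 hq1)).ne'
  rw [hq.2, exp_sub, exp_add, exp_add, exp_half_log hn, exp_I_mul_tauSeq]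
  have := exp_ne_zero (I * (tau lam ξ * q.1 / lam : ℝ))
  field_simp

/-- The extra terms in `p` multiply the bracket by `n ^ ((a - b) / λ) ζ ^ n`. This removes the
`n`-dependence of `r ^ (b - a) ζ ^ (-n)` and leaves `λ ^ ((a - b) / λ)`, so the second peak is now
of order one. -/
theorem exists_ratio_zTwo_eq (hf : Differentiable ℂ f) (hlam : 0 < lam) (hμ : μ < 1)
    (hζ : ‖ζ‖ = 1) (hθ0 : 0 < θ) (hθπ : θ < Real.pi) (hθlam : lam * θ < 2 * Real.pi)
    (hdisj : Disjoint (sector 1 θ) (sector ζ θ)) (hgrowth : TwoDirectionGrowth f a b A lam μ ζ θ)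
    (hξ : ξ ∈ limitCurve lam) (hξθ : |ξ.arg| < θ) (hξ1 : ξ ≠ 1) (hK : IsCompact K) :
    ∃ S T : ℕ × ℂ → ℂ,
      Tendsto S (atTop ×ˢ 𝓟 K) (𝓝 (1 / (1 - ξ) / (ξ ^ a * (√(2 * Real.pi * lam) : ℝ)))) ∧
      Tendsto T (atTop ×ˢ 𝓟 K)
        (𝓝 (A * (ζ / (ζ - ξ)) / (ξ ^ a * (√(2 * Real.pi * lam) : ℝ)))) ∧
      ∀ᶠ q in atTop ×ˢ 𝓟 K, f (radius lam q.1 * zTwo a b lam ζ ξ q.1 q.2) ≠ 0 ∧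
        ratio f lam q.1 (zTwo a b lam ζ ξ q.1 q.2) = 1 - exp (-q.2) *
          (((q.1 : ℝ) : ℂ) ^ ((a - b) / lam) * ζ ^ q.1 * S q +
            (lam : ℂ) ^ ((a - b) / lam) * T q) := by
  have hN : Tendsto (fun q : ℕ × ℂ => q.1) (atTop ×ˢ 𝓟 K) atTop := tendsto_fst
  have hζ0 : ζ ≠ 0 := norm_ne_zero_iff.1 (by rw [hζ]; exact one_ne_zero)
  obtain ⟨C, hC⟩ := hK.exists_bound_of_continuousOn (f := fun w : ℂ => w) continuousOn_id
  have hB : IsBoundedUnder (· ≤ ·) (atTop ×ˢ 𝓟 K)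
      (fun q : ℕ × ℂ => ‖-q.2 + I * sigmaSeq ζ q.1 + I * tauSeq lam ξ q.1‖) := by
    refine isBoundedUnder_of_eventually_le (a := C + Real.pi + Real.pi) ?_
    rw [eventually_prod_principal_iff]
    refine Eventually.of_forall fun n w hw => (norm_add₃_le).trans ?_
    rw [norm_neg, norm_mul, norm_I, one_mul, norm_real, norm_mul, norm_I, one_mul, norm_real]
    exact add_le_add (add_le_add (hC w hw) (abs_angleRep_le _)) (abs_angleRep_le _)
  obtain ⟨S, T, hS, hT, h⟩ := exists_ratio_eq hf hlam hμ hζ hθ0 hθπ hθlam hdisj hgrowth hξ hξθ hξ1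
    hN (tendsto_log_add_bounded_div_sqrt hN _ hB) fun q => zTwo_eq hlam a b ζ ξ q.1 q.2
  refine ⟨S, T, hS, hT, ?_⟩
  filter_upwards [h, hN.eventually_ge_atTop 1] with q hq hq1
  refine ⟨hq.1, ?_⟩
  have hn : q.1 ≠ 0 := Nat.one_le_iff_ne_zero.1 hq1
  have hsq : (√(q.1 : ℝ) : ℂ) ≠ 0 :=
    ofReal_ne_zero.2 (Real.sqrt_pos.2 (Nat.cast_pos.2 hq1)).ne'
  have hcancel : ((q.1 : ℝ) : ℂ) ^ ((a - b) / lam) * ((q.1 : ℝ) : ℂ) ^ ((b - a) / lam) = 1 := by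
    rw [← cpow_add _ _ (by simpa using hn), ← add_div, sub_add_sub_cancel, sub_self, zero_div,
      cpow_zero]
  have hζn : ζ ^ q.1 * (ζ ^ q.1)⁻¹ = 1 := mul_inv_cancel₀ (pow_ne_zero _ hζ0)
  have hexp : exp (((a - b) / lam + 1 / 2) * Real.log q.1 +
      (-q.2 + I * sigmaSeq ζ q.1 + I * tauSeq lam ξ q.1) - I * (tau lam ξ * q.1 / lam : ℝ)) /
      (√(q.1 : ℝ) : ℂ) = exp (-q.2) * (((q.1 : ℝ) : ℂ) ^ ((a - b) / lam) * ζ ^ q.1) := by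
    rw [exp_sub, exp_add, exp_add, exp_add, add_mul, exp_add, exp_half_log hn, exp_I_mul_tauSeq,
      exp_I_mul_sigmaSeq hζ, ← natCast_cpow_eq_exp hn]
    have := exp_ne_zero (I * (tau lam ξ * q.1 / lam : ℝ))
    field_simp
  rw [hq.2, hexp, radius_cpow hlam hn, neg_sub]
  linear_combination (-exp (-q.2) * ζ ^ q.1 * (ζ ^ q.1)⁻¹ * (lam : ℂ) ^ ((a - b) / lam) * T q) *
    hcancel - exp (-q.2) * (lam : ℂ) ^ ((a - b) / lam) * T q * hζn

end main

end ArcScaling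

/-! ### The three cases -/

open ArcScaling
theorem mainTheorem5 (f : ℂ → ℂ) (hf : Differentiable ℂ f)
    (a b A : ℂ) (lam μ : ℝ) (hlam : 0 < lam) (hμ : μ < 1)
    (ζ : ℂ) (hζ : ‖ζ‖ = 1) (hζ1 : ζ ≠ 1)
    (θ : ℝ) (hθ0 : 0 < θ) (hθπ : θ < Real.pi) (hθlam : lam * θ < 2 * Real.pi)
    (hdisj : Disjoint (sector 1 θ) (sector ζ θ))
    (hgrowth : TwoDirectionGrowth f a b A lam μ ζ θ)
    (ξ : ℂ) (hξ : ξ ∈ limitCurve lam) (hξθ : |ξ.arg| < θ) (hξ1 : ξ ≠ 1) :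
    (b.re < a.re → ∀ K : Set ℂ, IsCompact K →
      (∀ᶠ n : ℕ in Filter.atTop, ∀ w ∈ K, f (radius lam n * zOne lam ξ n w) ≠ 0) ∧
      TendstoUniformlyOn (fun n w => ratio f lam n (zOne lam ξ n w))
        (fun w => 1 - Complex.exp (-w) /
          (ξ ^ a * (1 - ξ) * (Real.sqrt (2 * Real.pi * lam) : ℂ)))
        Filter.atTop K) ∧
    (a.re < b.re → ∀ K : Set ℂ, IsCompact K →
      (∀ᶠ n : ℕ in Filter.atTop, ∀ w ∈ K, f (radius lam n * zTwo a b lam ζ ξ n w) ≠ 0) ∧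
      TendstoUniformlyOn (fun n w => ratio f lam n (zTwo a b lam ζ ξ n w))
        (fun w => 1 - A * ζ * (lam : ℂ) ^ ((a - b) / (lam : ℂ)) * Complex.exp (-w) /
          (ξ ^ a * (ζ - ξ) * (Real.sqrt (2 * Real.pi * lam) : ℂ)))
        Filter.atTop K) ∧
    (a.re = b.re → ∀ K : Set ℂ, IsCompact K →
      (∀ᶠ n : ℕ in Filter.atTop, ∀ w ∈ K, f (radius lam n * zOne lam ξ n w) ≠ 0) ∧
      TendstoUniformlyOn
        (fun n w => ratio f lam n (zOne lam ξ n w) -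
          (1 - (1 / (1 - ξ) + A * ζ ^ (1 - (n : ℤ)) * (radius lam n : ℂ) ^ (b - a) / (ζ - ξ)) *
            (Complex.exp (-w) / (ξ ^ a * (Real.sqrt (2 * Real.pi * lam) : ℂ)))))
        (fun _ => 0) Filter.atTop K) := by
  have hζ0 : ζ ≠ 0 := norm_ne_zero_iff.1 (by rw [hζ]; exact one_ne_zero)
  have hrad : ∀ K : Set ℂ,
      Tendsto (fun q : ℕ × ℂ => radius lam q.1) (atTop ×ˢ 𝓟 K) atTop := fun K =>
    (tendsto_radius hlam).comp tendsto_fst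
  refine ⟨fun hab K hK => ?_, fun hab K hK => ?_, fun hab K hK => ?_⟩
  · obtain ⟨S, T, hS, hT, h⟩ :=
      exists_ratio_zOne_eq hf hlam hμ hζ hθ0 hθπ hθlam hdisj hgrowth hξ hξθ hξ1 hK
    refine ⟨eventually_prod_principal_iff.1 (h.mono fun q hq => hq.1), ?_⟩
    rw [tendstoUniformlyOn_iff_tendsto_sub]
    have hb := isBoundedUnder_snd hK (fun w => Complex.exp (-w)) (by fun_prop)
    -- When `Re b < Re a` the second peak is negligible relative to the first.
    have hr0 : Tendsto (fun q : ℕ × ℂ => (radius lam q.1 : ℂ) ^ (b - a) * (ζ ^ q.1)⁻¹)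
        (atTop ×ˢ 𝓟 K) (𝓝 0) := by
      have h0 := tendsto_cpow_zero (hrad K) (s := b - a) (by simpa using hab)
      refine h0.zero_mul_isBoundedUnder_le ?_
      exact isBoundedUnder_of ⟨1, fun q => by simp [hζ]⟩
    have hlim := ((hS.sub_const (1 / (1 - ξ) / (ξ ^ a * (√(2 * Real.pi * lam) : ℝ)))).add
      (hr0.mul hT))
    rw [sub_self, zero_mul, add_zero] at hlim
    have hlim' := (hlim.zero_mul_isBoundedUnder_le hb).neg
    rw [neg_zero] at hlim'
    refine hlim'.congr' (h.mono fun q hq => ?_)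
    beta_reduce
    rw [hq.2]
    generalize 1 - ξ = u, ζ - ξ = v
    ring
  · obtain ⟨S, T, hS, hT, h⟩ :=
      exists_ratio_zTwo_eq hf hlam hμ hζ hθ0 hθπ hθlam hdisj hgrowth hξ hξθ hξ1 hK
    refine ⟨eventually_prod_principal_iff.1 (h.mono fun q hq => hq.1), ?_⟩
    rw [tendstoUniformlyOn_iff_tendsto_sub]
    have hb := isBoundedUnder_snd hK (fun w => Complex.exp (-w)) (by fun_prop)
    -- When `Re a < Re b` the roles are reversed, and the first peak dies out in the second scaling.
    have hr0 : Tendsto (fun q : ℕ × ℂ => ((q.1 : ℝ) : ℂ) ^ ((a - b) / lam) * ζ ^ q.1)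
        (atTop ×ˢ 𝓟 K) (𝓝 0) := by
      have h0 := tendsto_cpow_zero (L := atTop ×ˢ 𝓟 K) (x := fun q : ℕ × ℂ => (q.1 : ℝ))
        (tendsto_natCast_atTop_atTop.comp tendsto_fst) (s := (a - b) / lam) (by
          rw [Complex.div_ofReal_re]
          exact div_neg_of_neg_of_pos (by simpa using hab) hlam)
      refine h0.zero_mul_isBoundedUnder_le ?_
      exact isBoundedUnder_of ⟨1, fun q => by simp [hζ]⟩
    have hlim := (hr0.mul hS).add ((hT.sub_const
      (A * (ζ / (ζ - ξ)) / (ξ ^ a * (√(2 * Real.pi * lam) : ℝ)))).const_mul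
        ((lam : ℂ) ^ ((a - b) / lam)))
    rw [sub_self, zero_mul, mul_zero, add_zero] at hlim
    have hlim' := (hlim.zero_mul_isBoundedUnder_le hb).neg
    rw [neg_zero] at hlim'
    refine hlim'.congr' (h.mono fun q hq => ?_)
    beta_reduce
    rw [hq.2]
    generalize 1 - ξ = u, ζ - ξ = v
    ring
  · obtain ⟨S, T, hS, hT, h⟩ :=
      exists_ratio_zOne_eq hf hlam hμ hζ hθ0 hθπ hθlam hdisj hgrowth hξ hξθ hξ1 hK
    refine ⟨eventually_prod_principal_iff.1 (h.mono fun q hq => hq.1), ?_⟩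
    rw [tendstoUniformlyOn_iff_tendsto_sub]
    have hb := isBoundedUnder_snd hK (fun w => Complex.exp (-w)) (by fun_prop)
    -- When `Re a = Re b` the relative factor has modulus one and need not converge. It therefore
    -- stays in the comparison function, and only the deviation of `T` from its limit is multiplied
    -- by it.
    have hr1 : IsBoundedUnder (· ≤ ·) (atTop ×ˢ 𝓟 K)
        (fun q : ℕ × ℂ => ‖(radius lam q.1 : ℂ) ^ (b - a) * (ζ ^ q.1)⁻¹‖) := by
      refine isBoundedUnder_of_eventually_le (a := 1) ?_
      filter_upwards [(hrad K).eventually_gt_atTop 0] with q hq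
      simp [hζ, Complex.norm_cpow_eq_rpow_re_of_pos hq, hab]
    have hT0 := hT.sub_const (A * (ζ / (ζ - ξ)) / (ξ ^ a * (√(2 * Real.pi * lam) : ℝ)))
    rw [sub_self] at hT0
    have hlim := (hS.sub_const (1 / (1 - ξ) / (ξ ^ a * (√(2 * Real.pi * lam) : ℝ)))).add
      (hT0.zero_mul_isBoundedUnder_le hr1)
    rw [sub_self, zero_add] at hlim
    have hlim' := (hlim.zero_mul_isBoundedUnder_le hb).neg
    rw [neg_zero] at hlim'
    refine hlim'.congr' (h.mono fun q hq => ?_)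
    beta_reduce
    rw [hq.2, zpow_sub₀ hζ0, zpow_one, zpow_natCast]
    generalize 1 - ξ = u, ζ - ξ = v
    ring
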